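/- Let $n\ge 1$. On $\mathbb{R}^{2n+1}\times\mathbb{S}^1$, with coordinates $(x_1,y_1,\dots,x_n,y_n,z,\theta)$, consider the 1-form $\lambda=\sum_{i=1}^n(x_i\,dy_i-y_i\,dx_i)+2z\,d\theta$, and let $V=\mathbb{S}^{2n}\times\mathbb{S}^1=\{z^2+\sum_{i=1}^n(x_i^2+y_i^2)=1\}$, $\alpha=\lambda|_{V}$ and $\xi=\ker\alpha$. Then $\xi$ is a contact structure on $V$ (it is known to be tight; this is recalled here and is not part of the claim). Let $\Psi$ be the diffeomorphism of $V$ given by $\Psi(x,y,z,\theta)=(\varphi_\theta(x,y,z),\theta)$, where $\varphi_\theta:\mathbb{R}^{2n+1}\to\mathbb{R}^{2n+1}$ is the linear map that rotates the plane of the coordinates $(x_n,y_n)$ by the angle $\theta$ and fixes the coordinates $x_1,y_1,\dots,x_{n-1},y_{n-1},z$. Let $\mathrm{Diff}(V)$ be the group of smooth diffeomorphisms of $V$ with the $C^\infty$ topology, and $\mathrm{Diff}(V,\xi)$ the subgroup of contactomorphisms (diffeomorphisms $f$ with $f_*\xi=\xi$) with the induced topology. Then $\Psi$ is smoothly isotopic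 to a contactomorphism $\Psi_c\in\mathrm{Diff}(V,\xi)$ such that the class $[\Psi_c^2]\in\pi_0\mathrm{Diff}(V,\xi)$ generates an infinite cyclic subgroup of the kernel of the homomorphism $\pi_0\mathrm{Diff}(V,\xi)\to\pi_0\mathrm{Diff}(V)$ induced by the inclusion. -/

import Mathlib

open scoped Manifold ContDiff

noncomputable section

/-! ### The group `π₀` of a group with a topology -/

section PiZero

variable (G : Type*) [Group G] [TopologicalSpace G] [SeparatelyContinuousMul G]

/-- The path component of the identity, as a subgroup. -/
def identityPathComponent : Subgroup G where
  carrier := {g | Joined (1 : G) g}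
  one_mem' := Joined.refl 1
  mul_mem' := by
    intro a b ha hb
    have h : Joined (1 * b) (a * b) :=
      ha.map (f := fun g => g * b) SeparatelyContinuousMul.continuous_mul_const
    rw [one_mul] at h
    exact Joined.trans hb h
  inv_mem' := by
    intro a ha
    have h : Joined (a⁻¹ * 1) (a⁻¹ * a) :=
      ha.map (f := fun g => a⁻¹ * g) SeparatelyContinuousMul.continuous_const_mul
    rw [mul_one, inv_mul_cancel] at h
    exact h.symm

instance : (identityPathComponent G).Normal where
  conj_mem := by
    intro a ha g
    have h : Joined (g * 1 * g⁻¹) (g * a * g⁻¹) :=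
      ha.map (f := fun x => g * x * g⁻¹)
        (SeparatelyContinuousMul.continuous_mul_const.comp
          SeparatelyContinuousMul.continuous_const_mul)
    rw [mul_one, mul_inv_cancel] at h
    exact h

/-- `π₀(G)`: the group of path components of `G`. -/
abbrev PiZero : Type _ := G ⧸ identityPathComponent G

variable {G}

/-- The class `[g] ∈ π₀(G)`. -/
def PiZero.mk : G →* PiZero G := QuotientGroup.mk' (identityPathComponent G)

/-- Two elements have the same class in `π₀(G)` iff a path joins them. -/
theorem PiZero.mk_eq_mk_iff (a b : G) : PiZero.mk a = PiZero.mk b ↔ Joined a b := by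
  have h1 : PiZero.mk a = PiZero.mk b ↔ Joined (1 : G) (a⁻¹ * b) :=
    QuotientGroup.eq (s := identityPathComponent G)
  rw [h1]
  constructor
  · intro h
    have h' : Joined (a * 1) (a * (a⁻¹ * b)) :=
      h.map (f := fun g => a * g) SeparatelyContinuousMul.continuous_const_mul
    simpa using h'
  · intro h
    have h' : Joined (a⁻¹ * a) (a⁻¹ * b) :=
      h.map (f := fun g => a⁻¹ * g) SeparatelyContinuousMul.continuous_const_mul
    simpa using h'

/-- The homomorphism induced on `π₀` by a continuous homomorphism. -/
def PiZero.map {K : Type*} [Group K] [TopologicalSpace K] [SeparatelyContinuousMul K]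
    (j : G →* K) (hj : Continuous j) : PiZero G →* PiZero K :=
  QuotientGroup.map (identityPathComponent G) (identityPathComponent K) j (by
    intro g hg
    have h : Joined (j 1) (j g) := Joined.map (x := (1 : G)) (y := g) hg hj
    rw [map_one] at h
    exact h)

end PiZero

/-! ### Diffeomorphism groups, contactomorphism groups and isotopies -/

section Diffeomorphisms

variable {E : Type*} [NormedAddCommGroup E] [NormedSpace ℝ E] {H : Type*} [TopologicalSpace H]
  (I : ModelWithCorners ℝ E H) (M : Type*) [TopologicalSpace M] [ChartedSpace H M]

/-- `Diff(M)`: the group of smooth diffeomorphisms of `M`. -/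
abbrev DiffGroup : Type _ := M ≃ₘ^∞⟮I, I⟯ M

instance DiffGroup.instGroup : Group (DiffGroup I M) where
  mul f g := g.trans f
  one := Diffeomorph.refl I M ∞
  inv f := f.symm
  mul_assoc _ _ _ := rfl
  one_mul _ := rfl
  mul_one _ := rfl
  inv_mul_cancel f := Diffeomorph.ext fun x => f.symm_apply_apply x

variable {I M}

theorem DiffGroup.mul_apply (f g : DiffGroup I M) (x : M) : (f * g) x = f (g x) := rfl

theorem DiffGroup.one_apply (x : M) : (1 : DiffGroup I M) x = x := rfl

/-- `f` and `g` are smoothly isotopic: they are joined by a family of diffeomorphisms `F t`,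
`t ∈ [0,1]`, such that `(t, x) ↦ F t x` is smooth. -/
def SmoothlyIsotopic (f g : DiffGroup I M) : Prop :=
  ∃ F : unitInterval → DiffGroup I M,
    ContMDiff ((𝓡∂ 1).prod I) I ∞ (fun q : unitInterval × M => F q.1 q.2) ∧ F 0 = f ∧ F 1 = g

/-- `φ` preserves the field `ξ` of tangent subspaces: `dφ (ξ x) = ξ (φ x)` for all `x`. -/
def PreservesField (ξ : ∀ x : M, Submodule ℝ (TangentSpace I x)) (φ : DiffGroup I M) : Prop :=
  ∀ x : M, Submodule.map (mfderiv I I φ x).toLinearMap (ξ x) = ξ (φ x)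

/-- `Diff(M, ξ)`: the subgroup of the diffeomorphisms that preserve `ξ`. If `ξ` is a contact
structure, these are the contactomorphisms of `(M, ξ)`. -/
def ContactDiffGroup (ξ : ∀ x : M, Submodule ℝ (TangentSpace I x)) :
    Subgroup (DiffGroup I M) where
  carrier := {φ | PreservesField ξ φ}
  one_mem' := by
    intro x
    have h : mfderiv I I (1 : DiffGroup I M) x = ContinuousLinearMap.id ℝ (TangentSpace I x) :=
      mfderiv_id
    rw [h]
    exact Submodule.map_id _
  mul_mem' := by
    intro f g hf hg x
    have h : mfderiv I I (f * g) x = (mfderiv I I f (g x)).comp (mfderiv I I g x) :=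
      mfderiv_comp x (f.mdifferentiable (by simp) (g x)) (g.mdifferentiable (by simp) x)
    rw [h]
    change Submodule.map ((mfderiv I I f (g x)).toLinearMap ∘ₗ (mfderiv I I g x).toLinearMap) (ξ x)
      = ξ (f (g x))
    rw [Submodule.map_comp, hg x]
    exact hf (g x)
  inv_mem' := by
    intro f hf y
    obtain ⟨x, rfl⟩ : ∃ x, f x = y := ⟨f.symm y, f.apply_symm_apply y⟩
    have hx : (f⁻¹ : DiffGroup I M) (f x) = x := f.symm_apply_apply x
    have h : (mfderiv I I (f⁻¹ : DiffGroup I M) (f x)).comp (mfderiv I I f x)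
        = ContinuousLinearMap.id ℝ (TangentSpace I x) := by
      have h1 := mfderiv_comp x ((f⁻¹ : DiffGroup I M).mdifferentiable (by simp) (f x))
        (f.mdifferentiable (by simp) x)
      have h2 : (⇑(f⁻¹ : DiffGroup I M) ∘ ⇑f) = id := funext fun z => f.symm_apply_apply z
      rw [h2, mfderiv_id] at h1
      exact h1.symm
    rw [← hf x]
    ext v
    constructor
    · rintro ⟨w, ⟨u, hu, rfl⟩, rfl⟩
      have h3 := DFunLike.congr_fun h u
      change mfderiv I I (f⁻¹ : DiffGroup I M) (f x) (mfderiv I I f x u) = u at h3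
      change mfderiv I I (f⁻¹ : DiffGroup I M) (f x) (mfderiv I I f x u) ∈ _
      rw [h3]
      rw [hx]
      exact hu
    · intro hv
      have hv' : v ∈ ξ x := by
        rw [hx] at hv
        exact hv
      exact ⟨mfderiv I I f x v, ⟨v, hv', rfl⟩, DFunLike.congr_fun h v⟩

theorem DiffGroup.mfderiv_symm_comp (h : DiffGroup I M) (x : M) :
    (mfderiv I I h.symm (h x)).comp (mfderiv I I h x)
      = ContinuousLinearMap.id ℝ (TangentSpace I x) := by
  have h1 := mfderiv_comp x (h.symm.mdifferentiable (by simp) (h x))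
    (h.mdifferentiable (by simp) x)
  have h2 : (⇑h.symm ∘ ⇑h) = id := funext fun z => h.symm_apply_apply z
  rw [h2, mfderiv_id] at h1
  exact h1.symm

theorem DiffGroup.mfderiv_comp_symm (h : DiffGroup I M) (x : M) :
    (mfderiv I I h x).comp (mfderiv I I h.symm (h x))
      = ContinuousLinearMap.id ℝ (TangentSpace I (h x)) := by
  have h1 := DiffGroup.mfderiv_symm_comp h.symm (h x)
  have h2 : h.symm (h x) = x := h.symm_apply_apply x
  have h3 : h.symm.symm = h := rfl
  rw [h3, h2] at h1
  exact h1

end Diffeomorphisms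

/-! ### The `C^∞` topology -/

section Topology

variable {E : Type*} [NormedAddCommGroup E] [NormedSpace ℝ E] {H : Type*} [TopologicalSpace H]
  (I : ModelWithCorners ℝ E H) (M : Type*) [TopologicalSpace M] [ChartedSpace H M]
  [IsManifold I ∞ M]

/-- Smooth vector fields on `M`. -/
abbrev SmoothVectorField : Type _ := ContMDiffSection I E ∞ (fun x : M => TangentSpace I x)

variable {I M}

/-- The iterated derivative `X₁ (X₂ (⋯ (Xₖ φ)))` of a function `φ` along vector fields. -/
def iteratedLie : List (SmoothVectorField I M) → (M → ℝ) → (M → ℝ)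
  | [], φ => φ
  | X :: L, φ => fun x => mfderiv I 𝓘(ℝ, ℝ) (iteratedLie L φ) x (X x)

/-- For a smooth function `g` and smooth vector fields `X₁, …, Xₖ`, the map
`f ↦ X₁ ⋯ Xₖ (g ∘ f)`, with values in the functions on `M` with the topology of uniform
convergence on compact sets. -/
def iteratedLieComp (g : C^∞⟮I, M; ℝ⟯) (L : List (SmoothVectorField I M)) (f : DiffGroup I M) :
    UniformOnFun M ℝ {K : Set M | IsCompact K} :=
  UniformOnFun.ofFun {K : Set M | IsCompact K} (iteratedLie L (fun x => g (f x)))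

/-- The `C^∞` topology on `Diff(M)` (uniform convergence of all derivatives on compact sets): the
coarsest topology for which all the maps `f ↦ X₁ ⋯ Xₖ (g ∘ f)` are continuous. -/
instance DiffGroup.instTopologicalSpace : TopologicalSpace (DiffGroup I M) :=
  ⨅ (g : C^∞⟮I, M; ℝ⟯) (L : List (SmoothVectorField I M)),
    TopologicalSpace.induced (iteratedLieComp g L) inferInstance

theorem DiffGroup.continuous_iteratedLieComp (g : C^∞⟮I, M; ℝ⟯)
    (L : List (SmoothVectorField I M)) :
    Continuous (iteratedLieComp g L : DiffGroup I M → _) :=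
  continuous_iff_le_induced.2 ((iInf_le _ g).trans (iInf_le _ L))

theorem DiffGroup.continuous_iff {T : Type*} [TopologicalSpace T] (F : T → DiffGroup I M) :
    Continuous F ↔ ∀ (g : C^∞⟮I, M; ℝ⟯) (L : List (SmoothVectorField I M)),
      Continuous fun t => iteratedLieComp g L (F t) := by
  refine ⟨fun h g L => (DiffGroup.continuous_iteratedLieComp g L).comp h, fun h => ?_⟩
  refine continuous_iInf_rng.2 fun g => continuous_iInf_rng.2 fun L => ?_
  exact continuous_induced_rng.2 (h g L)

variable [CompleteSpace E]

/-- The push-forward of a vector field by a diffeomorphism. -/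
def SmoothVectorField.push (h : DiffGroup I M) (X : SmoothVectorField I M) :
    SmoothVectorField I M where
  toFun := VectorField.mpullback I I h.symm X
  contMDiff_toFun := by
    refine ContMDiff.mpullback_vectorField (n := ∞) X.contMDiff h.symm.contMDiff (fun y => ?_)
      (by simp)
    obtain ⟨x, rfl⟩ : ∃ x, h x = y := ⟨h.symm y, h.apply_symm_apply y⟩
    have hx : h.symm (h x) = x := h.symm_apply_apply x
    have h1 := DiffGroup.mfderiv_symm_comp h x
    have h2 := DiffGroup.mfderiv_comp_symm h x
    exact ContinuousLinearMap.IsInvertible.of_inverse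
      (g := mfderiv I I h x) h1 h2

theorem SmoothVectorField.push_apply (h : DiffGroup I M) (X : SmoothVectorField I M) (x : M) :
    SmoothVectorField.push h X (h x) = mfderiv I I h x (X x) := by
  have h1 := DiffGroup.mfderiv_symm_comp h x
  have h2 := DiffGroup.mfderiv_comp_symm h x
  have hx : h.symm (h x) = x := h.symm_apply_apply x
  have h3 : (mfderiv I I h.symm (h x)).inverse = mfderiv I I h x :=
    ContinuousLinearMap.inverse_eq h1 h2
  change (mfderiv I I h.symm (h x)).inverse (X (h.symm (h x))) = _
  rw [h3, hx]

theorem iteratedLie_comp (h : DiffGroup I M) (L : List (SmoothVectorField I M)) (φ : M → ℝ) :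
    iteratedLie L (fun x => φ (h x))
      = fun x => iteratedLie (L.map (SmoothVectorField.push h)) φ (h x) := by
  induction L with
  | nil => rfl
  | cons X L ih =>
    funext x
    simp only [iteratedLie, List.map_cons]
    rw [ih, SmoothVectorField.push_apply]
    set ψ := iteratedLie (L.map (SmoothVectorField.push h)) φ with hψ
    by_cases hd : MDifferentiableAt I 𝓘(ℝ, ℝ) ψ (h x)
    · have h1 : mfderiv I 𝓘(ℝ, ℝ) (ψ ∘ h) x
          = (mfderiv I 𝓘(ℝ, ℝ) ψ (h x)).comp (mfderiv I I h x) :=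
        mfderiv_comp x hd (h.mdifferentiable (by simp) x)
      exact DFunLike.congr_fun h1 (X x)
    · have hd' : ¬ MDifferentiableAt I 𝓘(ℝ, ℝ) (fun x => ψ (h x)) x := by
        intro hc
        apply hd
        have hs : h.symm (h x) = x := h.symm_apply_apply x
        have hc' : MDifferentiableAt I 𝓘(ℝ, ℝ) (fun x => ψ (h x)) (h.symm (h x)) := by
          rw [hs]; exact hc
        have h2 := hc'.comp (h x) (h.symm.mdifferentiable (by simp) (h x))
        have h3 : ((fun x => ψ (h x)) ∘ h.symm) = ψ :=
          funext fun z => congrArg ψ (h.apply_symm_apply z)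
        rwa [h3] at h2
      rw [mfderiv_zero_of_not_mdifferentiableAt hd, mfderiv_zero_of_not_mdifferentiableAt hd']
      rfl

/-- Left and right translations of `Diff(M)` are continuous. -/
instance DiffGroup.instSeparatelyContinuousMul : SeparatelyContinuousMul (DiffGroup I M) where
  continuous_const_mul := by
    intro a
    rw [DiffGroup.continuous_iff]
    intro g L
    exact DiffGroup.continuous_iteratedLieComp
      (g.comp (⟨a, a.contMDiff⟩ : C^∞⟮I, M; I, M⟯)) L
  continuous_mul_const := by
    intro a
    rw [DiffGroup.continuous_iff]
    intro g L
    have h1 : (fun f : DiffGroup I M => iteratedLieComp g L (f * a))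
        = fun f => UniformOnFun.ofFun {K : Set M | IsCompact K}
            (UniformOnFun.toFun {K : Set M | IsCompact K}
              (iteratedLieComp g (L.map (SmoothVectorField.push a)) f) ∘ a) := by
      funext f
      exact congrArg (UniformOnFun.ofFun {K : Set M | IsCompact K})
        (iteratedLie_comp a L (fun x => g (f x)))
    rw [h1]
    have h2 : Set.MapsTo (fun K : Set M => a '' K) {K : Set M | IsCompact K}
        {K : Set M | IsCompact K} := fun K hK => IsCompact.image hK a.continuous
    exact (UniformOnFun.precomp_uniformContinuous h2).continuous.comp
      (DiffGroup.continuous_iteratedLieComp g (L.map (SmoothVectorField.push a)))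

/-- `Diff(M, ξ)` carries the topology induced from `Diff(M)`; translations are continuous. -/
instance ContactDiffGroup.instSeparatelyContinuousMul
    (ξ : ∀ x : M, Submodule ℝ (TangentSpace I x)) :
    SeparatelyContinuousMul (ContactDiffGroup ξ) where
  continuous_const_mul := by
    intro a
    exact continuous_induced_rng.2
      ((SeparatelyContinuousMul.continuous_const_mul (a := (a : DiffGroup I M))).comp
        continuous_subtype_val)
  continuous_mul_const := by
    intro a
    exact continuous_induced_rng.2
      ((SeparatelyContinuousMul.continuous_mul_const (a := (a : DiffGroup I M))).comp
        continuous_subtype_val)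

/-- The homomorphism `π₀ Diff(M, ξ) → π₀ Diff(M)` induced by the inclusion. -/
def piZeroInclusion (ξ : ∀ x : M, Submodule ℝ (TangentSpace I x)) :
    PiZero (ContactDiffGroup ξ) →* PiZero (DiffGroup I M) :=
  PiZero.map (ContactDiffGroup ξ).subtype continuous_subtype_val

end Topology

/-! ### The manifold `S²ⁿ × S¹`, its contact form and the diffeomorphism `Ψ` -/

section Example

/-- `ℝ²ⁿ⁺¹` with coordinates `x i = p (.inl i)`, `y i = p (.inr (.inl i))` for `i : Fin n`, and
`z = p (.inr (.inr ()))`. -/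
abbrev OddSpace (n : ℕ) : Type := EuclideanSpace ℝ (Fin n ⊕ Fin n ⊕ Unit)

instance OddSpace.instFactFinrank (n : ℕ) :
    Fact (Module.finrank ℝ (OddSpace n) = 2 * n + 1) :=
  ⟨by rw [finrank_euclideanSpace]; simp; ring⟩

/-- The unit sphere `S²ⁿ` in `ℝ²ⁿ⁺¹`. -/
abbrev EvenSphere (n : ℕ) : Type := Metric.sphere (0 : OddSpace n) 1

/-- `V = S²ⁿ × S¹`, where `S¹` is the unit circle in `ℂ`, with angle `θ` at the point `e^{iθ}`. -/
abbrev SphereCircle (n : ℕ) : Type := EvenSphere n × Circle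

/-- The model with corners of `S²ⁿ × S¹`. -/
abbrev sphereCircleModel (n : ℕ) := (𝓡 (2 * n)).prod (𝓡 1)

/-- `dx_i` on `ℝ²ⁿ⁺¹ × ℝ`, the space of the coordinate vectors `(dx, dy, dz, dθ)`. -/
def dX {n : ℕ} (i : Fin n) : OddSpace n × ℝ →L[ℝ] ℝ :=
  (EuclideanSpace.proj (Sum.inl i) : OddSpace n →L[ℝ] ℝ).comp (ContinuousLinearMap.fst ℝ _ ℝ)

/-- `dy_i`. -/
def dY {n : ℕ} (i : Fin n) : OddSpace n × ℝ →L[ℝ] ℝ :=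
  (EuclideanSpace.proj (Sum.inr (Sum.inl i)) : OddSpace n →L[ℝ] ℝ).comp
    (ContinuousLinearMap.fst ℝ _ ℝ)

/-- `dθ`. -/
def dTheta {n : ℕ} : OddSpace n × ℝ →L[ℝ] ℝ := ContinuousLinearMap.snd ℝ _ ℝ

/-- The form `λ = ∑ (x_i dy_i - y_i dx_i) + 2 z dθ` on `ℝ²ⁿ⁺¹ × S¹` in the coordinates
`(x, y, z, θ)`; its coefficients at `(q, θ)` do not depend on `θ`. -/
def ambientForm {n : ℕ} (q : OddSpace n) : OddSpace n × ℝ →L[ℝ] ℝ :=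
  ∑ i : Fin n, (q (Sum.inl i) • dY i - q (Sum.inr (Sum.inl i)) • dX i)
    + (2 * q (Sum.inr (Sum.inr ()))) • dTheta

/-- The exterior derivative `dλ (u, v) = D_u λ (v) - D_v λ (u)`, in the same coordinates. -/
def ambientFormDeriv {n : ℕ} (q : OddSpace n) (u v : OddSpace n × ℝ) : ℝ :=
  fderiv ℝ (ambientForm (n := n)) q u.1 v - fderiv ℝ (ambientForm (n := n)) q v.1 u

/-- The differential at `p ∈ S²ⁿ × S¹` of the coordinates `(x, y, z, θ)`, where
`dθ = Im (ū du)` for the coordinate `u = e^{iθ}` of the circle. -/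
def coordDifferential {n : ℕ} (p : SphereCircle n) :
    TangentSpace (sphereCircleModel n) p →L[ℝ] OddSpace n × ℝ :=
  ContinuousLinearMap.prod
    (mfderiv (sphereCircleModel n) 𝓘(ℝ, OddSpace n)
      (fun q : SphereCircle n => (q.1 : OddSpace n)) p)
    (Complex.imCLM.comp ((ContinuousLinearMap.mul ℝ ℂ ((starRingEnd ℂ) (p.2 : ℂ))).comp
      (mfderiv (sphereCircleModel n) 𝓘(ℝ, ℂ) (fun q : SphereCircle n => (q.2 : ℂ)) p)))

/-- The restriction `α` of `λ` to `S²ⁿ × S¹`. -/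
def contactForm {n : ℕ} (p : SphereCircle n) :
    TangentSpace (sphereCircleModel n) p →L[ℝ] ℝ :=
  (ambientForm (p.1 : OddSpace n)).comp (coordDifferential p)

/-- `dα`, the restriction of `dλ` to `S²ⁿ × S¹`. -/
def contactFormDeriv {n : ℕ} (p : SphereCircle n)
    (u v : TangentSpace (sphereCircleModel n) p) : ℝ :=
  ambientFormDeriv (p.1 : OddSpace n) (coordDifferential p u) (coordDifferential p v)

/-- `ξ = ker α`. -/
def contactStructure (n : ℕ) (p : SphereCircle n) :
    Submodule ℝ (TangentSpace (sphereCircleModel n) p) :=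
  LinearMap.ker (contactForm p).toLinearMap

/-- `ξ = ker α` is a contact structure: `α` vanishes nowhere and `dα` is nondegenerate on `ξ`. -/
def IsContactKernel (n : ℕ) : Prop :=
  ∀ p : SphereCircle n, contactForm p ≠ 0 ∧
    ∀ u ∈ contactStructure n p, (∀ v ∈ contactStructure n p, contactFormDeriv p u v = 0) → u = 0

/-- For `u = e^{iθ}`: the rotation by the angle `θ` of the plane of the coordinates
`(x_k, y_k)` of `ℝ²ⁿ⁺¹`; the other coordinates are fixed. -/
def planeRotation {n : ℕ} (k : Fin n) (u : ℂ) (q : OddSpace n) : OddSpace n :=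
  WithLp.toLp 2 (Sum.elim
    (fun i => if i = k then u.re * q (Sum.inl i) - u.im * q (Sum.inr (Sum.inl i))
      else q (Sum.inl i))
    (Sum.elim
      (fun i => if i = k then u.im * q (Sum.inl i) + u.re * q (Sum.inr (Sum.inl i))
        else q (Sum.inr (Sum.inl i)))
      (fun _ => q (Sum.inr (Sum.inr ())))))

theorem planeRotation_norm {n : ℕ} (k : Fin n) (u : Circle) (q : OddSpace n) :
    ‖planeRotation k (u : ℂ) q‖ = ‖q‖ := by
  have hu : (u : ℂ).re * (u : ℂ).re + (u : ℂ).im * (u : ℂ).im = 1 := by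
    have h := Circle.normSq_coe u
    rwa [Complex.normSq_apply] at h
  rw [EuclideanSpace.norm_eq, EuclideanSpace.norm_eq]
  congr 1
  simp only [Fintype.sum_sum_type, planeRotation, Sum.elim_inl, Sum.elim_inr, Real.norm_eq_abs,
    sq_abs]
  rw [← add_assoc, ← add_assoc, ← Finset.sum_add_distrib, ← Finset.sum_add_distrib]
  congr 1
  refine Finset.sum_congr rfl fun i _ => ?_
  split_ifs
  · linear_combination (q (Sum.inl i) ^ 2 + q (Sum.inr (Sum.inl i)) ^ 2) * hu
  · rfl

theorem planeRotation_planeRotation {n : ℕ} (k : Fin n) (u w : Circle) (h : w * u = 1)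
    (q : OddSpace n) : planeRotation k (w : ℂ) (planeRotation k (u : ℂ) q) = q := by
  have h1 : (w : ℂ) * (u : ℂ) = 1 := by rw [← Circle.coe_mul, h, Circle.coe_one]
  have hr : (w : ℂ).re * (u : ℂ).re - (w : ℂ).im * (u : ℂ).im = 1 := by
    simpa using congrArg Complex.re h1
  have hi : (w : ℂ).re * (u : ℂ).im + (w : ℂ).im * (u : ℂ).re = 0 := by
    simpa using congrArg Complex.im h1
  ext j
  rcases j with i | i | i
  · simp only [planeRotation, Sum.elim_inl, Sum.elim_inr]
    split_ifs
    · linear_combination q (Sum.inl i) * hr - q (Sum.inr (Sum.inl i)) * hi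
    · rfl
  · simp only [planeRotation, Sum.elim_inl, Sum.elim_inr]
    split_ifs
    · linear_combination q (Sum.inl i) * hi + q (Sum.inr (Sum.inl i)) * hr
    · rfl
  · simp only [planeRotation, Sum.elim_inr]

theorem contDiff_planeRotation {n : ℕ} (k : Fin n) :
    ContDiff ℝ ∞ fun a : ℂ × OddSpace n => planeRotation k a.1 a.2 := by
  have hre : ContDiff ℝ ∞ fun a : ℂ × OddSpace n => a.1.re :=
    Complex.reCLM.contDiff.comp contDiff_fst
  have him : ContDiff ℝ ∞ fun a : ℂ × OddSpace n => a.1.im :=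
    Complex.imCLM.contDiff.comp contDiff_fst
  have hc : ∀ j, ContDiff ℝ ∞ fun a : ℂ × OddSpace n => a.2 j := fun j =>
    (EuclideanSpace.proj (𝕜 := ℝ) j : OddSpace n →L[ℝ] ℝ).contDiff.comp contDiff_snd
  rw [contDiff_euclidean]
  rintro (i | i | i)
  · by_cases hik : i = k
    · simpa [planeRotation, hik] using
        (hre.mul (hc (Sum.inl k))).sub (him.mul (hc (Sum.inr (Sum.inl k))))
    · simpa [planeRotation, hik] using hc (Sum.inl i)
  · by_cases hik : i = k
    · simpa [planeRotation, hik] using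
        (him.mul (hc (Sum.inl k))).add (hre.mul (hc (Sum.inr (Sum.inl k))))
    · simpa [planeRotation, hik] using hc (Sum.inr (Sum.inl i))
  · simpa [planeRotation] using hc (Sum.inr (Sum.inr ()))

/-- The map `(p, u) ↦ (p rotated in the plane (x_k, y_k) by the angle of c u, u)`, where `c` is a
map of the circle to itself. -/
def rotationMap {n : ℕ} (k : Fin n) (c : Circle → Circle) (p : SphereCircle n) : SphereCircle n :=
  (⟨planeRotation k (c p.2 : ℂ) p.1, by
    rw [mem_sphere_zero_iff_norm, planeRotation_norm]
    exact mem_sphere_zero_iff_norm.1 p.1.2⟩, p.2)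

theorem contMDiff_rotationMap {n : ℕ} (k : Fin n) (c : Circle → Circle)
    (hc : ContMDiff (𝓡 1) (𝓡 1) ∞ c) :
    ContMDiff (sphereCircleModel n) (sphereCircleModel n) ∞ (rotationMap k c) := by
  have hcoe : ContMDiff (𝓡 1) 𝓘(ℝ, ℂ) ∞ (fun u : Circle => (u : ℂ)) :=
    haveI := finrank_real_complex_fact'
    contMDiff_coe_sphere (E := ℂ) (n := 1)
  have h1 : ContMDiff (sphereCircleModel n) 𝓘(ℝ, ℂ) ∞
      (fun p : SphereCircle n => (c p.2 : ℂ)) := hcoe.comp (hc.comp contMDiff_snd)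
  have h2 : ContMDiff (sphereCircleModel n) 𝓘(ℝ, OddSpace n) ∞
      (fun p : SphereCircle n => (p.1 : OddSpace n)) :=
    (contMDiff_coe_sphere (E := OddSpace n) (n := 2 * n)).comp contMDiff_fst
  have h3 : ContMDiff (sphereCircleModel n) 𝓘(ℝ, OddSpace n) ∞
      (fun p : SphereCircle n => planeRotation k (c p.2 : ℂ) p.1) :=
    (contDiff_planeRotation k).contMDiff.comp (h1.prodMk_space h2)
  have h4 := ContMDiff.codRestrict_sphere (n := 2 * n) h3 (fun p => (rotationMap k c p).1.2)
  exact h4.prodMk contMDiff_snd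

/-- The diffeomorphism `Ψ` of `S²ⁿ × S¹` (for the plane `(x_k, y_k)`). -/
def rotationDiffeo {n : ℕ} (k : Fin n) : DiffGroup (sphereCircleModel n) (SphereCircle n) where
  toFun := rotationMap k (fun u => u)
  invFun := rotationMap k (fun u => u⁻¹)
  left_inv := by
    intro p
    refine Prod.ext (Subtype.ext ?_) rfl
    exact planeRotation_planeRotation k p.2 p.2⁻¹ (inv_mul_cancel _) p.1
  right_inv := by
    intro p
    refine Prod.ext (Subtype.ext ?_) rfl
    exact planeRotation_planeRotation k p.2⁻¹ p.2 (mul_inv_cancel _) p.1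
  contMDiff_toFun := contMDiff_rotationMap k _ contMDiff_id
  contMDiff_invFun := contMDiff_rotationMap k _ (contMDiff_inv (𝓡 1) ∞)

/-- `Ψ (x, y, z, θ) = (φ_θ (x, y, z), θ)`, where `φ_θ` rotates the last plane `(x_n, y_n)` by the
angle `θ`. The index of that plane is `n - 1` because `Fin n` starts at `0`. -/
def psi (n : ℕ) (hn : 1 ≤ n) : DiffGroup (sphereCircleModel n) (SphereCircle n) :=
  rotationDiffeo (⟨n - 1, by omega⟩ : Fin n)

end Example

end

/-! Read the vectors (dx, dy, dz, dθ) as (dx + i dy, dz + i dθ) in ℂⁿ⁺¹. Then dλ is twice the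
standard symplectic form ω, and λ is the contraction of dλ with the Liouville field X = (x/2, y/2,
z, 0). Since ⟨N, X⟩ > 0 for the normal N = (x, y, z, 0) of V, the form α is contact
(`isContactKernel`).

Write r² = x_k² + y_k² for the rotated plane. Then Ψ^*α = α + r² dθ (`contactForm_rotationDiffeo`).
The shear z ↦ z - r²/2 changes λ by -r² dθ, and the dilations (√s x, √s y, s z), which form the flow
of X, multiply λ by s. The shear, brought back to V by these dilations, therefore cancels the error
of Ψ: the composite `rotationContactomorphism` multiplies α by a positive function
(`contactForm_shearDiffeo`). The isotopy from Ψ scales the shear by t ∈ [0,1].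

The rotation by π in the plane (y_k, z) is isotopic to the identity and conjugates Ψ to its inverse.
So [Ψ]² = 1 in π₀ Diff(V) (`mk_rotationDiffeo_sq`), which puts [Ψ_c²] in the kernel.

Infinite order is seen by a Maslov-type winding number. Through the pole (0, 0, 1) over each u ∈ S¹
passes a Legendrian disc with y = 0 and θ constant. A contactomorphism f carries it to a Legendrian
disc, whose tangent space together with X is Lagrangian in ℂⁿ⁺¹; a real basis of a Lagrangian
subspace is a complex basis, so its complex determinant `frameDet f u` is not zero
(`det_frameMatrix_ne_zero`). The determinant is continuous in f for the C^∞ topology and in u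
(`continuous_frameDet`), so a path of contactomorphisms gives a homotopy of loops in ℂ \ {0}. For
Ψ_c^m the loop is u ↦ u^m (`frameDet_rotationContactomorphism_pow`), which is homotopic to the
constant loop only for m = 0 (`eq_zero_of_homotopy_pow`). -/

noncomputable section

/-! ### Smooth families of diffeomorphisms and the C^∞ topology -/

section Isotopy

variable {E : Type*} [NormedAddCommGroup E] [NormedSpace ℝ E] {H : Type*} [TopologicalSpace H]
  {I : ModelWithCorners ℝ E H} {M : Type*} [TopologicalSpace M] [ChartedSpace H M]

/-- A family of diffeomorphisms that depends smoothly on a real parameter is an isotopy. -/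
theorem SmoothlyIsotopic.of_real {Φ : ℝ → DiffGroup I M}
    (hΦ : ContMDiff (𝓘(ℝ, ℝ).prod I) I ∞ fun q : ℝ × M => Φ q.1 q.2) :
    SmoothlyIsotopic (Φ 0) (Φ 1) := by
  refine ⟨fun t => Φ t, ?_, by simp, by simp⟩
  exact hΦ.comp ((contMDiff_subtypeVal_Icc.comp contMDiff_fst).prodMk contMDiff_snd)

end Isotopy

section SmoothFamilies

variable {E : Type*} [NormedAddCommGroup E] [NormedSpace ℝ E] {H : Type*} [TopologicalSpace H]
  {I : ModelWithCorners ℝ E H} {M : Type*} [TopologicalSpace M] [ChartedSpace H M]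
  [IsManifold I ∞ M]
  {F : Type*} [NormedAddCommGroup F] [NormedSpace ℝ F] {K : Type*} [TopologicalSpace K]
  {J : ModelWithCorners ℝ F K} {T : Type*} [TopologicalSpace T] [ChartedSpace K T]
  [IsManifold J ∞ T]

/-- The derivative of a smooth function along a smooth vector field is smooth. -/
theorem contMDiff_mfderiv_apply_section {N : Type*} [TopologicalSpace N] [ChartedSpace H N]
    [IsManifold I ∞ N] {φ : N → ℝ} (hφ : ContMDiff I 𝓘(ℝ, ℝ) ∞ φ)
    {T' : Type*} [TopologicalSpace T'] [ChartedSpace K T']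
    {s : T' → TangentBundle I N} (hs : ContMDiff J I.tangent ∞ s) :
    ContMDiff J 𝓘(ℝ, ℝ) ∞ (fun q => (mfderiv I 𝓘(ℝ, ℝ) φ (s q).1 (s q).2 : ℝ)) :=
  (contMDiff_snd_tangentBundle_modelSpace ℝ 𝓘(ℝ, ℝ)).comp
    ((hφ.contMDiff_tangentMap (m := ∞) (by simp)).comp hs)

/-- A vector field on `M`, as a vertical vector field on `T × M`. -/
theorem contMDiff_vertical_section (X : SmoothVectorField I M) :
    ContMDiff (J.prod I) (J.prod I).tangent ∞
      (fun q : T × M => (⟨q, ((0 : F), (X q.2 : E))⟩ : TangentBundle (J.prod I) (T × M))) := by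
  have h1 : ContMDiff (J.prod I) J.tangent ∞
      (fun q : T × M => (⟨q.1, (0 : F)⟩ : TangentBundle J T)) :=
    (Bundle.contMDiff_zeroSection ℝ (TangentSpace J : T → Type _)).comp contMDiff_fst
  have h2 : ContMDiff (J.prod I) I.tangent ∞
      (fun q : T × M => (⟨q.2, X q.2⟩ : TangentBundle I M)) :=
    X.contMDiff.comp contMDiff_snd
  have : IsManifold J 1 T := IsManifold.of_le (n := ∞) (by simp)
  have : IsManifold I 1 M := IsManifold.of_le (n := ∞) (by simp)
  exact (contMDiff_equivTangentBundleProd_symm (I := J) (M := T) (I' := I) (M' := M)).comp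
    (h1.prodMk h2)

/-- Differentiating along X in the fibre `M` is the same as differentiating the function on `T × M`
along the vertical field (0, X), so smoothness in both variables survives each derivative. -/
theorem contMDiff_iteratedLie_family (L : List (SmoothVectorField I M)) {φ : T × M → ℝ}
    (hφ : ContMDiff (J.prod I) 𝓘(ℝ, ℝ) ∞ φ) :
    ContMDiff (J.prod I) 𝓘(ℝ, ℝ) ∞
      (fun q : T × M => iteratedLie L (fun x => φ (q.1, x)) q.2) := by
  induction L with
  | nil => exact hφ
  | cons X L ih =>
    have h := contMDiff_mfderiv_apply_section ih (contMDiff_vertical_section (J := J) (T := T) X)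
    refine h.congr fun q => ?_
    -- Chain rule for the inclusion of the fibre over `q.1`, whose differential sends X to (0, X).
    have h1 := mfderiv_comp (I := I) (I' := J.prod I) (I'' := 𝓘(ℝ, ℝ)) q.2
      (f := fun x : M => ((q.1, x) : T × M))
      (g := fun q : T × M => iteratedLie L (fun x => φ (q.1, x)) q.2)
      ((ih q).mdifferentiableAt (by simp))
      (mdifferentiableAt_const.prodMk mdifferentiableAt_id)
    have h2 := DFunLike.congr_fun h1 (X q.2)
    refine h2.trans ?_
    change mfderiv (J.prod I) 𝓘(ℝ, ℝ) (fun q : T × M => iteratedLie L (fun x => φ (q.1, x)) q.2) q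
      (mfderiv I (J.prod I) (fun x : M => ((q.1, x) : T × M)) q.2 (X q.2)) = _
    congr 1
    exact DFunLike.congr_fun (mfderiv_prod_right (I := J) (I' := I) (x₀ := q.1) (y₀ := q.2)) (X q.2)

/-- A jointly continuous family of functions is continuous for the compact-open topology. -/
theorem continuous_uniformOnFun_of_uncurry {S N : Type*} [TopologicalSpace S] [TopologicalSpace N]
    {φ : S → N → ℝ} (hφ : Continuous fun q : S × N => φ q.1 q.2) :
    Continuous fun s => UniformOnFun.ofFun {K : Set N | IsCompact K} (φ s) :=
  ContinuousMap.isUniformEmbedding_toUniformOnFunIsCompact.isInducing.continuous.comp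
    (ContinuousMap.curry ⟨_, hφ⟩).continuous

/-- A smooth family of diffeomorphisms is continuous for the `C^∞` topology. -/
theorem DiffGroup.continuous_of_contMDiff {Φ : T → DiffGroup I M}
    (hΦ : ContMDiff (J.prod I) I ∞ fun q : T × M => Φ q.1 q.2) : Continuous Φ := by
  rw [DiffGroup.continuous_iff]
  intro g L
  exact continuous_uniformOnFun_of_uncurry
    (contMDiff_iteratedLie_family L (g.contMDiff.comp hΦ)).continuous

/-- Smoothly isotopic diffeomorphisms are joined by a path. -/
theorem SmoothlyIsotopic.joined {f g : DiffGroup I M} (h : SmoothlyIsotopic f g) : Joined f g := by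
  obtain ⟨Φ, hΦ, h0, h1⟩ := h
  exact ⟨⟨⟨Φ, DiffGroup.continuous_of_contMDiff hΦ⟩, h0, h1⟩⟩

/-- The velocity at time `0` of a smooth one-parameter family of maps that starts at the
identity. -/
def velocityField (Φ : ℝ × M → M) (hΦ : ContMDiff (𝓘(ℝ, ℝ).prod I) I ∞ Φ)
    (h0 : ∀ p, Φ (0, p) = p) : SmoothVectorField I M where
  toFun p := (mfderiv (𝓘(ℝ, ℝ).prod I) I Φ (0, p) ((1 : ℝ), (0 : E)) : E)
  contMDiff_toFun := by
    have h1 : ContMDiff I 𝓘(ℝ, ℝ).tangent ∞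
        (fun _ : M => (⟨0, (1 : ℝ)⟩ : TangentBundle 𝓘(ℝ, ℝ) ℝ)) := contMDiff_const
    have h2 : ContMDiff I I.tangent ∞ (fun q : M => (⟨q, (0 : E)⟩ : TangentBundle I M)) :=
      Bundle.contMDiff_zeroSection ℝ (TangentSpace I : M → Type _)
    have : IsManifold I 1 M := IsManifold.of_le (n := ∞) (by simp)
    have h3 := (contMDiff_equivTangentBundleProd_symm (I := 𝓘(ℝ, ℝ)) (M := ℝ) (I' := I)
      (M' := M)).comp (h1.prodMk h2)
    have h4 := (hΦ.contMDiff_tangentMap (m := ∞) (by simp)).comp h3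
    refine h4.congr fun p => ?_
    change (⟨p, _⟩ : TangentBundle I M) = ⟨Φ (0, p), _⟩
    congr 1
    · exact (h0 p).symm

/-- Chain rule along t ↦ (t, p). It turns derivatives along explicit curves into Lie derivatives
along a global field, which are what the C^∞ topology controls. -/
theorem mfderiv_velocityField {Φ : ℝ × M → M} (hΦ : ContMDiff (𝓘(ℝ, ℝ).prod I) I ∞ Φ)
    (h0 : ∀ p, Φ (0, p) = p) {φ : M → ℝ} (hφ : ContMDiff I 𝓘(ℝ, ℝ) ∞ φ) (p : M) :
    mfderiv I 𝓘(ℝ, ℝ) φ p (velocityField Φ hΦ h0 p) = deriv (fun t : ℝ => φ (Φ (t, p))) 0 := by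
  -- The velocity is computed at Φ(0, p), which equals p only propositionally; this moves the base
  -- point.
  have hp : ∀ q : M, q = p → ∀ v : E, (mfderiv I 𝓘(ℝ, ℝ) φ p v : ℝ) = mfderiv I 𝓘(ℝ, ℝ) φ q v := by
    rintro q rfl v
    rfl
  have h1 := mfderiv_comp (I := 𝓘(ℝ, ℝ)) (I' := 𝓘(ℝ, ℝ).prod I) (I'' := 𝓘(ℝ, ℝ)) (0 : ℝ)
    (f := fun t : ℝ => (t, p)) (g := φ ∘ Φ)
    ((hφ.comp hΦ (0, p)).mdifferentiableAt (by simp))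
    (mdifferentiableAt_id.prodMk mdifferentiableAt_const)
  have h2 := mfderiv_comp (I := 𝓘(ℝ, ℝ).prod I) (I' := I) (I'' := 𝓘(ℝ, ℝ)) ((0 : ℝ), p)
    (f := Φ) (g := φ) ((hφ _).mdifferentiableAt (by simp)) ((hΦ _).mdifferentiableAt (by simp))
  have h3 := DFunLike.congr_fun h1 (1 : ℝ)
  have h4 := DFunLike.congr_fun
    (mfderiv_prod_left (I := 𝓘(ℝ, ℝ)) (I' := I) (x₀ := (0 : ℝ)) (y₀ := p)) (1 : ℝ)
  rw [mfderiv_eq_fderiv] at h3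
  refine (hp _ (h0 p) _).trans (Eq.trans ?_ h3.symm)
  refine Eq.trans ?_ (congrArg (mfderiv (𝓘(ℝ, ℝ).prod I) 𝓘(ℝ, ℝ) (φ ∘ Φ) ((0 : ℝ), p)) h4.symm)
  exact (DFunLike.congr_fun h2 (((1 : ℝ), (0 : E)))).symm

end SmoothFamilies

/-! ### Winding numbers of loops in ℂ \ {0} -/

section Winding

/-- `f` and a constant are lifts of the same map through the covering `Circle.exp`, and they agree
at one point. This replaces the argument that a continuous function with values in 2πℤ is constant.
-/
theorem Circle.eq_of_exp_eq_one {f : ℝ → ℝ} (hf : Continuous f)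
    (h : ∀ x, Circle.exp (f x) = 1) (x y : ℝ) : f x = f y := by
  have h1 : f = fun _ => f y := by
    refine Circle.isCoveringMap_exp.eq_of_comp_eq hf continuous_const ?_ y rfl
    funext z
    simp [h]
  exact congrFun h1 x

/-- The loop `u ↦ u ^ m` in `ℂ \ {0}` is contractible only for `m = 0`. -/
theorem eq_zero_of_homotopy_pow {m : ℕ} {h : unitInterval → Circle → ℂ}
    (hc : Continuous fun q : unitInterval × Circle => h q.1 q.2) (hne : ∀ t u, h t u ≠ 0)
    (h0 : ∀ u, h 0 u = 1) (h1 : ∀ u : Circle, h 1 u = (u : ℂ) ^ m) : m = 0 := by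
  -- The time is extended to ℝ and the circle unrolled, so that the homotopy lives on the simply
  -- connected ℝ × ℝ and lifts through `Circle.exp`.
  let pr : ℝ → unitInterval := Set.projIcc 0 1 zero_le_one
  have hpr : Continuous pr := continuous_projIcc
  have hpr0 : pr 0 = 0 := Set.projIcc_left _
  have hpr1 : pr 1 = 1 := Set.projIcc_right _
  have hk : Continuous fun q : ℝ × ℝ => h (pr q.1) (Circle.exp q.2) :=
    hc.comp ((hpr.comp continuous_fst).prodMk (Circle.exp.continuous.comp continuous_snd))
  let g : C(ℝ × ℝ, Circle) :=
    ⟨fun q => ⟨h (pr q.1) (Circle.exp q.2) / ‖h (pr q.1) (Circle.exp q.2)‖,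
      mem_sphere_zero_iff_norm.2 (by
        rw [norm_div, Complex.norm_real, norm_norm, div_self (norm_ne_zero_iff.2 (hne _ _))])⟩, by
      refine Continuous.subtype_mk (hk.div (Complex.continuous_ofReal.comp hk.norm) fun q => ?_) _
      exact Complex.ofReal_ne_zero.2 (norm_ne_zero_iff.2 (hne _ _))⟩
  have hgc : ∀ t θ, (g (t, θ) : ℂ)
      = h (pr t) (Circle.exp θ) / ‖h (pr t) (Circle.exp θ)‖ := fun _ _ => rfl
  obtain ⟨e₀, he₀⟩ : ∃ e, Circle.exp e = g 0 := ⟨_, Circle.exp_arg (g 0)⟩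
  obtain ⟨L, ⟨-, hL⟩, -⟩ := Circle.isCoveringMap_exp.existsUnique_continuousMap_lifts g 0 e₀ he₀
  have hL' : ∀ t θ, Circle.exp (L (t, θ)) = g (t, θ) := fun t θ => congrFun hL (t, θ)
  have hg0 : ∀ θ, g (0, θ) = 1 := by
    intro θ
    ext
    rw [hgc, hpr0, h0]
    simp
  have hg1 : ∀ θ, g (1, θ) = Circle.exp θ ^ m := by
    intro θ
    ext
    rw [hgc, hpr1, h1]
    simp
  have hp : ∀ t, g (t, 2 * Real.pi) = g (t, 0) := by
    intro t
    ext
    rw [hgc, hgc, Circle.exp_two_pi, Circle.exp_zero]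
  -- The increment of the lifted angle around the loop is a multiple of 2π, hence independent of the
  -- time; it is 0 at time 0 and 2πm at time 1.
  have hd : L (0, 2 * Real.pi) - L (0, 0) = L (1, 2 * Real.pi) - L (1, 0) := by
    refine Circle.eq_of_exp_eq_one (f := fun t => L (t, 2 * Real.pi) - L (t, 0))
      (by fun_prop) (fun t => ?_) 0 1
    rw [Circle.exp_sub, hL', hL', hp, div_self']
  have hd0 : L (0, 2 * Real.pi) = L (0, 0) := by
    refine Circle.eq_of_exp_eq_one (f := fun θ => L (0, θ)) (by fun_prop) (fun θ => ?_) _ _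
    rw [hL', hg0]
  have hd1 : L (1, 2 * Real.pi) - m * (2 * Real.pi) = L (1, 0) - m * 0 := by
    refine Circle.eq_of_exp_eq_one (f := fun θ => L (1, θ) - m * θ) (by fun_prop) (fun θ => ?_) _ _
    rw [Circle.exp_sub, hL', hg1, ← nsmul_eq_mul, Circle.exp_nsmul, div_self']
  have hm : (m : ℝ) * (2 * Real.pi) = 0 := by linarith
  have : (m : ℝ) = 0 := (mul_eq_zero.1 hm).resolve_right (by positivity)
  exact_mod_cast this

end Winding

/-! ### Lagrangian frames are complex frames -/

section Lagrangian

open Matrix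
open scoped ComplexOrder

/-- The columns of `A` span a Lagrangian subspace if the matrix of their Hermitian products is
real. Columns of that kind that are independent over `ℝ` are independent over `ℂ`. -/
theorem det_ne_zero_of_lagrangian {ι : Type*} [Fintype ι] [DecidableEq ι] {A : Matrix ι ι ℂ}
    (hA : ∀ i j, ((Aᴴ * A) i j).im = 0)
    (hI : ∀ r : ι → ℝ, A *ᵥ (fun i => (r i : ℂ)) = 0 → r = 0) : A.det ≠ 0 := by
  intro hdet
  obtain ⟨c, hc0, hc⟩ := Matrix.exists_mulVec_eq_zero_iff.2 hdet
  have hS : (Aᴴ * A) *ᵥ c = 0 := by rw [← Matrix.mulVec_mulVec, hc, Matrix.mulVec_zero]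
  -- The Gram matrix Aᴴ A has the same kernel as A. As it is real, it kills the real and the
  -- imaginary part of `c` separately.
  have hreal : ∀ r : ι → ℝ, (Aᴴ * A) *ᵥ (fun i => (r i : ℂ)) = 0 → r = 0 := fun r hr =>
    hI r ((Matrix.conjTranspose_mul_self_mulVec_eq_zero A _).1 hr)
  have hre : (fun i => (c i).re) = 0 := by
    apply hreal
    funext i
    have h := congrFun hS i
    simp only [Matrix.mulVec, dotProduct, Pi.zero_apply] at h ⊢
    apply Complex.ext
    · have := congrArg Complex.re h
      simpa [Complex.re_sum, hA] using this
    · simp [Complex.im_sum, hA]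
  have him : (fun i => (c i).im) = 0 := by
    apply hreal
    funext i
    have h := congrFun hS i
    simp only [Matrix.mulVec, dotProduct, Pi.zero_apply] at h ⊢
    apply Complex.ext
    · have := congrArg Complex.im h
      simpa [Complex.im_sum, hA] using this
    · simp [Complex.im_sum, hA]
  exact hc0 (funext fun i => Complex.ext (congrFun hre i) (congrFun him i))

end Lagrangian

/-! ### Tangent vectors in ambient coordinates, and the contact condition -/

section CoordinateDifferential

variable {n : ℕ}

theorem contMDiff_circle_coe : ContMDiff (𝓡 1) 𝓘(ℝ, ℂ) ∞ (fun u : Circle => (u : ℂ)) :=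
  have := finrank_real_complex_fact'
  contMDiff_coe_sphere (E := ℂ) (n := 1)

theorem contMDiff_evenSphere_coe :
    ContMDiff (𝓡 (2 * n)) 𝓘(ℝ, OddSpace n) ∞ (fun q : EvenSphere n => (q : OddSpace n)) :=
  contMDiff_coe_sphere (E := OddSpace n) (n := 2 * n)

/-- The differential of the inclusion of the sphere. -/
def sphereDifferential (q : EvenSphere n) : TangentSpace (𝓡 (2 * n)) q →L[ℝ] OddSpace n :=
  mfderiv (𝓡 (2 * n)) 𝓘(ℝ, OddSpace n) (fun q : EvenSphere n => (q : OddSpace n)) q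

/-- The differential of the inclusion of the circle. -/
def circleDifferential (u : Circle) : TangentSpace (𝓡 1) u →L[ℝ] ℂ :=
  mfderiv (𝓡 1) 𝓘(ℝ, ℂ) (fun u : Circle => (u : ℂ)) u

theorem sphereDifferential_injective (q : EvenSphere n) :
    Function.Injective (sphereDifferential q) :=
  injective_mvfderiv_subtypeVal_sphere (E := OddSpace n) (n := 2 * n) q

theorem range_sphereDifferential (q : EvenSphere n) :
    (sphereDifferential q).range = (ℝ ∙ (q : OddSpace n))ᗮ :=
  range_mvfderiv_subtypeVal (E := OddSpace n) (n := 2 * n) q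

theorem circleDifferential_injective (u : Circle) :
    Function.Injective (circleDifferential u) :=
  have := finrank_real_complex_fact'
  injective_mvfderiv_subtypeVal_sphere (E := ℂ) (n := 1) u

theorem range_circleDifferential (u : Circle) :
    (circleDifferential u).range = (ℝ ∙ (u : ℂ))ᗮ :=
  have := finrank_real_complex_fact'
  range_mvfderiv_subtypeVal (E := ℂ) (n := 1) u

theorem coordDifferential_apply (p : SphereCircle n)
    (v : TangentSpace (sphereCircleModel n) p) :
    coordDifferential p v = (sphereDifferential p.1 v.1,
      ((starRingEnd ℂ) (p.2 : ℂ) * circleDifferential p.2 v.2).im) := by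
  have h1 := mfderiv_comp (I := sphereCircleModel n) (I' := 𝓡 (2 * n)) (I'' := 𝓘(ℝ, OddSpace n)) p
    (f := Prod.fst) (g := fun q : EvenSphere n => (q : OddSpace n))
    ((contMDiff_evenSphere_coe _).mdifferentiableAt (by simp)) mdifferentiableAt_fst
  have h2 := mfderiv_comp (I := sphereCircleModel n) (I' := 𝓡 1) (I'' := 𝓘(ℝ, ℂ)) p
    (f := Prod.snd) (g := fun u : Circle => (u : ℂ))
    ((contMDiff_circle_coe _).mdifferentiableAt (by simp)) mdifferentiableAt_snd
  rw [mfderiv_fst] at h1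
  rw [mfderiv_snd] at h2
  refine Prod.ext (DFunLike.congr_fun h1 v) ?_
  exact congrArg (fun w : ℂ => ((starRingEnd ℂ) (p.2 : ℂ) * w).im) (DFunLike.congr_fun h2 v)

theorem re_conj_mul_circleDifferential (u : Circle) (v : TangentSpace (𝓡 1) u) :
    ((starRingEnd ℂ) (u : ℂ) * circleDifferential u v).re = 0 := by
  have h : circleDifferential u v ∈ (circleDifferential u).range := ⟨v, rfl⟩
  rw [range_circleDifferential, Submodule.mem_orthogonal_singleton_iff_inner_right,
    Complex.inner] at h
  simpa [mul_comm] using h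

/-- Tangent vectors of the circle are orthogonal to u, so ū du is purely imaginary, ū du = i dθ;
multiply by u. -/
theorem circleDifferential_eq (u : Circle) (v : TangentSpace (𝓡 1) u) :
    circleDifferential u v
      = ((starRingEnd ℂ) (u : ℂ) * circleDifferential u v).im * (Complex.I * u) := by
  have h1 : (starRingEnd ℂ) (u : ℂ) * circleDifferential u v
      = ((starRingEnd ℂ) (u : ℂ) * circleDifferential u v).im * Complex.I := by
    apply Complex.ext
    · simpa using re_conj_mul_circleDifferential u v
    · simp
  have h2 : (u : ℂ) * (starRingEnd ℂ) (u : ℂ) = 1 := by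
    rw [Complex.mul_conj, Circle.normSq_coe, Complex.ofReal_one]
  linear_combination (u : ℂ) * h1 - circleDifferential u v * h2

theorem coordDifferential_injective (p : SphereCircle n) :
    Function.Injective (coordDifferential p) := by
  rw [injective_iff_map_eq_zero]
  intro v hv
  rw [coordDifferential_apply] at hv
  have h1 : sphereDifferential p.1 v.1 = 0 := congrArg Prod.fst hv
  have h2 : ((starRingEnd ℂ) (p.2 : ℂ) * circleDifferential p.2 v.2).im = 0 := congrArg Prod.snd hv
  have h3 : circleDifferential p.2 v.2 = 0 := by
    refine (circleDifferential_eq p.2 v.2).trans ?_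
    rw [h2]
    simp
  refine Prod.ext ?_ ?_
  · exact sphereDifferential_injective p.1 (h1.trans (map_zero _).symm)
  · exact circleDifferential_injective p.2 (h3.trans (map_zero _).symm)

theorem inner_coordDifferential (p : SphereCircle n)
    (v : TangentSpace (sphereCircleModel n) p) :
    inner ℝ (p.1 : OddSpace n) (coordDifferential p v).1 = 0 := by
  rw [coordDifferential_apply]
  have h : sphereDifferential p.1 v.1 ∈ (sphereDifferential p.1).range := ⟨v.1, rfl⟩
  rwa [range_sphereDifferential, Submodule.mem_orthogonal_singleton_iff_inner_right] at h

/-- With `inner_coordDifferential` and injectivity this identifies the tangent space of V with the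
hyperplane orthogonal to N, so that statements about ξ become linear algebra in ℝ²ⁿ⁺¹ × ℝ. -/
theorem exists_coordDifferential_eq (p : SphereCircle n) (w : OddSpace n × ℝ)
    (hw : inner ℝ (p.1 : OddSpace n) w.1 = 0) :
    ∃ v : TangentSpace (sphereCircleModel n) p, coordDifferential p v = w := by
  have h1 : w.1 ∈ (sphereDifferential p.1).range := by
    rwa [range_sphereDifferential, Submodule.mem_orthogonal_singleton_iff_inner_right]
  have hu : (p.2 : ℂ).re * (p.2 : ℂ).re + (p.2 : ℂ).im * (p.2 : ℂ).im = 1 := by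
    have h := Circle.normSq_coe p.2
    rwa [Complex.normSq_apply] at h
  have h2 : (w.2 : ℂ) * (Complex.I * p.2) ∈ (circleDifferential p.2).range := by
    rw [range_circleDifferential, Submodule.mem_orthogonal_singleton_iff_inner_right,
      Complex.inner]
    simp
    ring
  obtain ⟨v1, hv1⟩ := h1
  obtain ⟨v2, hv2⟩ := h2
  refine ⟨(v1, v2), ?_⟩
  refine (coordDifferential_apply p _).trans (Prod.ext hv1 ?_)
  have h3 : circleDifferential p.2 v2 = (w.2 : ℂ) * (Complex.I * p.2) := hv2
  change ((starRingEnd ℂ) (p.2 : ℂ) * circleDifferential p.2 v2).im = w.2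
  rw [h3]
  simp
  linear_combination w.2 * hu

theorem ambientForm_apply (q : OddSpace n) (w : OddSpace n × ℝ) :
    ambientForm q w = ∑ i : Fin n, (q (Sum.inl i) * w.1 (Sum.inr (Sum.inl i))
      - q (Sum.inr (Sum.inl i)) * w.1 (Sum.inl i)) + 2 * q (Sum.inr (Sum.inr ())) * w.2 := by
  simp [ambientForm, dX, dY, dTheta]

/-- The coefficients of λ are linear in the point, so the derivative of `ambientForm` in the
direction `w` is `ambientForm w`. -/
theorem ambientFormDeriv_apply (q : OddSpace n) (u v : OddSpace n × ℝ) :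
    ambientFormDeriv q u v = ∑ i : Fin n, 2 * (u.1 (Sum.inl i) * v.1 (Sum.inr (Sum.inl i))
      - u.1 (Sum.inr (Sum.inl i)) * v.1 (Sum.inl i))
      + 2 * (u.1 (Sum.inr (Sum.inr ())) * v.2 - v.1 (Sum.inr (Sum.inr ())) * u.2) := by
  have hlin : IsLinearMap ℝ (ambientForm (n := n)) := by
    constructor
    · intro a b
      refine ContinuousLinearMap.ext fun w => ?_
      rw [add_apply, ambientForm_apply, ambientForm_apply, ambientForm_apply]
      simp only [PiLp.add_apply, add_mul, mul_add, Finset.sum_sub_distrib, Finset.sum_add_distrib]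
      ring
    · intro c a
      refine ContinuousLinearMap.ext fun w => ?_
      rw [smul_apply, ambientForm_apply, ambientForm_apply, smul_eq_mul, mul_add, Finset.mul_sum]
      simp only [PiLp.smul_apply, smul_eq_mul]
      congr 1
      · exact Finset.sum_congr rfl fun i _ => by ring
      · ring
  have hd : ∀ w : OddSpace n, fderiv ℝ (ambientForm (n := n)) q w = ambientForm w := fun w =>
    DFunLike.congr_fun (LinearMap.toContinuousLinearMap (hlin.mk' _)).fderiv w
  rw [ambientFormDeriv, hd, hd, ambientForm_apply, ambientForm_apply]
  simp only [mul_sub, Finset.sum_sub_distrib, ← Finset.mul_sum]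
  simp only [mul_comm (v.1 _) (u.1 _)]
  ring

theorem inner_oddSpace (a b : OddSpace n) :
    inner ℝ a b = ∑ i : Fin n, (a (Sum.inl i) * b (Sum.inl i)
      + a (Sum.inr (Sum.inl i)) * b (Sum.inr (Sum.inl i)))
      + a (Sum.inr (Sum.inr ())) * b (Sum.inr (Sum.inr ())) := by
  simp [PiLp.inner_apply, Fintype.sum_sum_type, Finset.sum_add_distrib, add_assoc, mul_comm]

/-- `(x, y, z)` and `θ` as a vector of `ℝ²ⁿ⁺¹ × ℝ`. -/
def oddVector (x y : Fin n → ℝ) (z θ : ℝ) : OddSpace n × ℝ :=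
  (WithLp.toLp 2 (Sum.elim x (Sum.elim y fun _ => z)), θ)

theorem sum_sq_add_sq_evenSphere (q : EvenSphere n) :
    ∑ i : Fin n, ((q : OddSpace n) (Sum.inl i) ^ 2 + (q : OddSpace n) (Sum.inr (Sum.inl i)) ^ 2)
      + (q : OddSpace n) (Sum.inr (Sum.inr ())) ^ 2 = 1 := by
  have h1 : ‖(q : OddSpace n)‖ ^ 2 = 1 := by rw [mem_sphere_zero_iff_norm.1 q.2]; norm_num
  rw [← real_inner_self_eq_norm_sq, inner_oddSpace] at h1
  simpa [sq] using h1

/-- `⟨N, X⟩` is positive. -/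
theorem half_sum_add_sq_pos (q : EvenSphere n) :
    0 < (1 / 2 : ℝ) * ∑ i : Fin n,
        ((q : OddSpace n) (Sum.inl i) ^ 2 + (q : OddSpace n) (Sum.inr (Sum.inl i)) ^ 2)
      + (q : OddSpace n) (Sum.inr (Sum.inr ())) ^ 2 := by
  have h := sum_sq_add_sq_evenSphere q
  nlinarith [sq_nonneg ((q : OddSpace n) (Sum.inr (Sum.inr ())))]

/-- With J the multiplication by i on ℂⁿ⁺¹, dλ(U, JU) = 2|U|². For U in ξ, the vector JU can be
moved into ξ by adding multiples of X and JN, and neither changes its pairing with U: dλ(U, X) =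
-λ(U) = 0 and dλ(U, JN) = 2⟨U, N⟩ = 0. Here `ρ` = ⟨N, X⟩. -/
theorem isContactKernel (n : ℕ) : IsContactKernel n := by
  intro p
  set q : OddSpace n := p.1.1 with hq
  set x : Fin n → ℝ := fun i => q (Sum.inl i) with hx
  set y : Fin n → ℝ := fun i => q (Sum.inr (Sum.inl i)) with hy
  set z : ℝ := q (Sum.inr (Sum.inr ())) with hz
  have hpos : 0 < (1 / 2 : ℝ) * ∑ i, (x i ^ 2 + y i ^ 2) + z ^ 2 := half_sum_add_sq_pos p.1
  set ρ : ℝ := (1 / 2 : ℝ) * ∑ i, (x i ^ 2 + y i ^ 2) + z ^ 2 with hρ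
  constructor
  · intro h0
    -- The witness is JN, tangent to V, with λ(JN) = 2ρ > 0.
    obtain ⟨v, hv⟩ := exists_coordDifferential_eq p (oddVector (-y) x 0 z) (by
      rw [inner_oddSpace]
      simp only [oddVector, Sum.elim_inl, Sum.elim_inr, Pi.neg_apply, mul_zero, add_zero]
      exact Finset.sum_eq_zero fun i _ => by ring)
    have h1 : ambientForm q (coordDifferential p v) = 0 := DFunLike.congr_fun h0 v
    rw [hv, ambientForm_apply] at h1
    simp only [oddVector, Sum.elim_inl, Sum.elim_inr, Pi.neg_apply] at h1
    have h2 : ∑ i, (x i * x i - y i * -y i) = ∑ i, (x i ^ 2 + y i ^ 2) :=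
      Finset.sum_congr rfl fun i _ => by ring
    change ∑ i, (x i * x i - y i * -y i) + 2 * z * z = 0 at h1
    rw [h2] at h1
    nlinarith
  · intro u hu hv
    have hu : ambientForm q (coordDifferential p u) = 0 := hu
    have hN := inner_coordDifferential p u
    apply coordDifferential_injective p
    rw [map_zero]
    have hv : ∀ w : OddSpace n × ℝ, inner ℝ q w.1 = 0 → ambientForm q w = 0 →
        ambientFormDeriv q (coordDifferential p u) w = 0 := by
      intro w hw1 hw2
      obtain ⟨v, rfl⟩ := exists_coordDifferential_eq p w hw1
      exact hv v hw2
    generalize coordDifferential p u = U at hu hN hv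
    obtain ⟨a, ha⟩ : ∃ a : Fin n → ℝ, ∀ i, U.1 (Sum.inl i) = a i := ⟨_, fun _ => rfl⟩
    obtain ⟨b, hb⟩ : ∃ b : Fin n → ℝ, ∀ i, U.1 (Sum.inr (Sum.inl i)) = b i := ⟨_, fun _ => rfl⟩
    obtain ⟨c, hc⟩ : ∃ c : ℝ, U.1 (Sum.inr (Sum.inr ())) = c := ⟨_, rfl⟩
    obtain ⟨d, hd⟩ : ∃ d : ℝ, U.2 = d := ⟨_, rfl⟩
    have hqx : ∀ i, q (Sum.inl i) = x i := fun _ => rfl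
    have hqy : ∀ i, q (Sum.inr (Sum.inl i)) = y i := fun _ => rfl
    have hqz : q (Sum.inr (Sum.inr ())) = z := rfl
    rw [ambientForm_apply] at hu
    rw [← hq, inner_oddSpace] at hN
    simp only [ha, hb, hc, hd, hqx, hqy, hqz] at hu hN
    set R : ℝ := ∑ i, (x i ^ 2 + y i ^ 2) with hR
    obtain ⟨S, hS⟩ : ∃ S, S = ∑ i, (x i * b i - y i * a i) := ⟨_, rfl⟩
    obtain ⟨Q, hQ⟩ : ∃ Q, Q = ∑ i, (x i * a i + y i * b i) := ⟨_, rfl⟩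
    rw [← hS] at hu
    rw [← hQ] at hN
    -- A and B are chosen so that JU - A X - B JN is orthogonal to N and in the kernel of λ: ⟨N, JU⟩
    -- = -S - zd, ⟨N, X⟩ = ρ, λ(JU) = Q + 2zc and λ(JN) = 2ρ, while ⟨N, JN⟩ = 0 = λ(X).
    obtain ⟨A, hA⟩ : ∃ A, A * ρ = -S - z * d := ⟨(-S - z * d) / ρ, div_mul_cancel₀ _ hpos.ne'⟩
    obtain ⟨B, hB⟩ : ∃ B, B * ρ = Q / 2 + z * c := ⟨(Q / 2 + z * c) / ρ, div_mul_cancel₀ _ hpos.ne'⟩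
    have hvs := hv (oddVector (fun i => -b i - A * (x i / 2) + B * y i)
      (fun i => a i - A * (y i / 2) - B * x i) (-d - A * z) (c - B * z)) ?_ ?_
    · rw [ambientFormDeriv_apply] at hvs
      simp only [oddVector, Sum.elim_inl, Sum.elim_inr, ha, hb, hc, hd] at hvs
      have h1 : ∑ i, 2 * (a i * (a i - A * (y i / 2) - B * x i)
          - b i * (-b i - A * (x i / 2) + B * y i))
          = 2 * ∑ i, (a i ^ 2 + b i ^ 2) + A * S - 2 * B * Q := by
        rw [hS, hQ, Finset.mul_sum, Finset.mul_sum, Finset.mul_sum, ← Finset.sum_add_distrib,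
          ← Finset.sum_sub_distrib]
        exact Finset.sum_congr rfl fun i _ => by ring
      rw [h1] at hvs
      -- Half of dλ(U, JU), after the two corrections drop out by λ(U) = 0 and ⟨N, U⟩ = 0.
      have h2 : ∑ i, (a i ^ 2 + b i ^ 2) + c ^ 2 + d ^ 2 = 0 := by
        linear_combination hvs / 2 - A / 2 * hu + B * hN
      have h3 : 0 ≤ ∑ i, (a i ^ 2 + b i ^ 2) := Finset.sum_nonneg fun i _ => by positivity
      have h4 : ∑ i, (a i ^ 2 + b i ^ 2) = 0 := by linarith [sq_nonneg c, sq_nonneg d]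
      have h5 : c = 0 := pow_eq_zero_iff two_ne_zero |>.1 (by linarith [sq_nonneg c, sq_nonneg d])
      have h6 : d = 0 := pow_eq_zero_iff two_ne_zero |>.1 (by linarith [sq_nonneg c, sq_nonneg d])
      have h7 : ∀ i, a i ^ 2 + b i ^ 2 = 0 := fun i =>
        (Finset.sum_eq_zero_iff_of_nonneg fun i _ => by positivity).1 h4 i (Finset.mem_univ i)
      refine Prod.ext ?_ (hd.trans h6)
      ext j
      rcases j with i | i | i
      · rw [ha]
        change a i = 0
        exact pow_eq_zero_iff two_ne_zero |>.1 (by linarith [h7 i, sq_nonneg (a i), sq_nonneg (b i)])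
      · rw [hb]
        change b i = 0
        exact pow_eq_zero_iff two_ne_zero |>.1 (by linarith [h7 i, sq_nonneg (a i), sq_nonneg (b i)])
      · exact hc.trans h5
    · rw [inner_oddSpace]
      simp only [oddVector, Sum.elim_inl, Sum.elim_inr, hqx, hqy, hqz]
      have h1 : ∑ i, (x i * (-b i - A * (x i / 2) + B * y i)
          + y i * (a i - A * (y i / 2) - B * x i)) = -S - A / 2 * R := by
        rw [hS, hR, Finset.mul_sum, ← Finset.sum_neg_distrib, ← Finset.sum_sub_distrib]
        exact Finset.sum_congr rfl fun i _ => by ring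
      rw [h1]
      linear_combination -hA + A * hρ
    · rw [ambientForm_apply]
      simp only [oddVector, Sum.elim_inl, Sum.elim_inr, hqx, hqy, hqz]
      have h1 : ∑ i, (x i * (a i - A * (y i / 2) - B * x i)
          - y i * (-b i - A * (x i / 2) + B * y i)) = Q - B * R := by
        rw [hQ, hR, Finset.mul_sum, ← Finset.sum_sub_distrib]
        exact Finset.sum_congr rfl fun i _ => by ring
      rw [h1]
      linear_combination -2 * hB + 2 * B * hρ

end CoordinateDifferential

/-! ### The shear of the sphere along weighted dilations -/

section Shear

/-- The positive solution `s` of `s W + s² c² = 1`. -/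
def dilationFactor (W c : ℝ) : ℝ := 2 / (W + √(W ^ 2 + 4 * c ^ 2))

theorem dilationFactor_denom_pos {W c : ℝ} (hW : 0 ≤ W) (h : 0 < W + c ^ 2) :
    0 < W + √(W ^ 2 + 4 * c ^ 2) := by
  rcases hW.eq_or_lt with h0 | h0
  · subst h0
    have h1 : 0 < c ^ 2 := by simpa using h
    have h2 : 0 < √(0 ^ 2 + 4 * c ^ 2) := Real.sqrt_pos.2 (by nlinarith)
    linarith
  · have := Real.sqrt_nonneg (W ^ 2 + 4 * c ^ 2)
    linarith

theorem dilationFactor_pos {W c : ℝ} (hW : 0 ≤ W) (h : 0 < W + c ^ 2) :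
    0 < dilationFactor W c :=
  div_pos two_pos (dilationFactor_denom_pos hW h)

/-- The quadratic formula with the root moved to the denominator, so that it stays valid at c = 0,
where the equation is linear. -/
theorem dilationFactor_equation {W c : ℝ} (hW : 0 ≤ W) (h : 0 < W + c ^ 2) :
    dilationFactor W c * W + dilationFactor W c ^ 2 * c ^ 2 = 1 := by
  have h1 := (dilationFactor_denom_pos hW h).ne'
  have h2 : √(W ^ 2 + 4 * c ^ 2) ^ 2 = W ^ 2 + 4 * c ^ 2 := Real.sq_sqrt (by positivity)
  unfold dilationFactor
  generalize √(W ^ 2 + 4 * c ^ 2) = r at h1 h2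
  field_simp
  linear_combination -h2

/-- The difference of the equations for two solutions s, r is (s - r)(W + (s + r)c²), with positive
second factor. This uniqueness is what makes the shears a one-parameter group. -/
theorem eq_dilationFactor {W c s : ℝ} (hW : 0 ≤ W) (h : 0 < W + c ^ 2) (hs : 0 < s)
    (he : s * W + s ^ 2 * c ^ 2 = 1) : s = dilationFactor W c := by
  have h1 := dilationFactor_equation hW h
  have h2 := dilationFactor_pos hW h
  set r := dilationFactor W c
  have h3 : (s - r) * (W + (s + r) * c ^ 2) = 0 := by linear_combination he - h1
  have h4 : 0 < W + (s + r) * c ^ 2 := by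
    rcases hW.eq_or_lt with h0 | h0
    · subst h0
      have : 0 < c ^ 2 := by simpa using h
      positivity
    · positivity
  linarith [(mul_eq_zero.1 h3).resolve_right h4.ne']

variable {n : ℕ}

/-- `x_k² + y_k²`. -/
def planeNormSq (k : Fin n) (q : OddSpace n) : ℝ := q (Sum.inl k) ^ 2 + q (Sum.inr (Sum.inl k)) ^ 2

/-- `∑ (x_i² + y_i²)`. -/
def horizontalNormSq (q : OddSpace n) : ℝ := ∑ i : Fin n, planeNormSq i q

/-- `z - t (x_k² + y_k²) / 2`. -/
def shearHeight (k : Fin n) (t : ℝ) (q : OddSpace n) : ℝ :=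
  q (Sum.inr (Sum.inr ())) - t * planeNormSq k q / 2

/-- The factor of the dilation `(x, y, z) ↦ (√s x, √s y, s z)` that takes
`(x, y, z - t (x_k² + y_k²) / 2)` to the unit sphere. -/
def shearFactor (k : Fin n) (t : ℝ) (q : OddSpace n) : ℝ :=
  dilationFactor (horizontalNormSq q) (shearHeight k t q)

/-- The shear `z ↦ z - t (x_k² + y_k²) / 2`, followed by the radial projection to the unit sphere
along the dilations `(x, y, z) ↦ (√s x, √s y, s z)`. -/
def shearMap (k : Fin n) (t : ℝ) (q : OddSpace n) : OddSpace n :=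
  WithLp.toLp 2 (Sum.elim (fun i => √(shearFactor k t q) * q (Sum.inl i))
    (Sum.elim (fun i => √(shearFactor k t q) * q (Sum.inr (Sum.inl i)))
      (fun _ => shearFactor k t q * shearHeight k t q)))

theorem planeNormSq_nonneg (k : Fin n) (q : OddSpace n) : 0 ≤ planeNormSq k q := by
  unfold planeNormSq; positivity

theorem horizontalNormSq_nonneg (q : OddSpace n) : 0 ≤ horizontalNormSq q :=
  Finset.sum_nonneg fun _ _ => planeNormSq_nonneg _ _

theorem horizontalNormSq_add_sq (q : EvenSphere n) :
    horizontalNormSq (q : OddSpace n) + (q : OddSpace n) (Sum.inr (Sum.inr ())) ^ 2 = 1 :=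
  sum_sq_add_sq_evenSphere q

theorem norm_sq_oddSpace (q : OddSpace n) :
    ‖q‖ ^ 2 = horizontalNormSq q + q (Sum.inr (Sum.inr ())) ^ 2 := by
  rw [← real_inner_self_eq_norm_sq, inner_oddSpace]
  simp [horizontalNormSq, planeNormSq, sq]

/-- The sheared point is never the origin: where x and y vanish, the shear does nothing and z² = 1.
-/
theorem horizontalNormSq_add_shearHeight_pos (k : Fin n) (t : ℝ) (q : EvenSphere n) :
    0 < horizontalNormSq (q : OddSpace n) + shearHeight k t (q : OddSpace n) ^ 2 := by
  have h := horizontalNormSq_add_sq q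
  rcases (horizontalNormSq_nonneg (q : OddSpace n)).eq_or_lt with h0 | h0
  · have h1 : planeNormSq k (q : OddSpace n) = 0 :=
      (Finset.sum_eq_zero_iff_of_nonneg fun i _ => planeNormSq_nonneg i _).1 h0.symm k
        (Finset.mem_univ k)
    rw [shearHeight, h1, ← h0]
    rw [← h0] at h
    simp only [mul_zero, zero_div, sub_zero]
    linarith
  · positivity

theorem shearFactor_pos (k : Fin n) (t : ℝ) (q : EvenSphere n) :
    0 < shearFactor k t (q : OddSpace n) :=
  dilationFactor_pos (horizontalNormSq_nonneg _) (horizontalNormSq_add_shearHeight_pos k t q)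

theorem planeNormSq_shearMap (k i : Fin n) (t : ℝ) (q : EvenSphere n) :
    planeNormSq i (shearMap k t (q : OddSpace n))
      = shearFactor k t (q : OddSpace n) * planeNormSq i (q : OddSpace n) := by
  have h := Real.sq_sqrt (shearFactor_pos k t q).le
  simp only [planeNormSq, shearMap, Sum.elim_inl, Sum.elim_inr]
  linear_combination ((q : OddSpace n) (Sum.inl i) ^ 2
    + (q : OddSpace n) (Sum.inr (Sum.inl i)) ^ 2) * h

theorem horizontalNormSq_shearMap (k : Fin n) (t : ℝ) (q : EvenSphere n) :
    horizontalNormSq (shearMap k t (q : OddSpace n))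
      = shearFactor k t (q : OddSpace n) * horizontalNormSq (q : OddSpace n) := by
  simp only [horizontalNormSq, planeNormSq_shearMap, Finset.mul_sum]

theorem norm_shearMap (k : Fin n) (t : ℝ) (q : EvenSphere n) :
    ‖shearMap k t (q : OddSpace n)‖ = 1 := by
  have h : ‖shearMap k t (q : OddSpace n)‖ ^ 2 = 1 := by
    rw [norm_sq_oddSpace, horizontalNormSq_shearMap]
    have h1 := dilationFactor_equation (horizontalNormSq_nonneg _)
      (horizontalNormSq_add_shearHeight_pos k t q)
    change shearFactor k t (q : OddSpace n) * horizontalNormSq (q : OddSpace n)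
      + (shearFactor k t (q : OddSpace n) * shearHeight k t (q : OddSpace n)) ^ 2 = 1
    rw [mul_pow]
    exact h1
  exact (pow_eq_one_iff_of_nonneg (norm_nonneg _) two_ne_zero).1 h

/-- `shearMap` as a map of the sphere. -/
def shearSphere (k : Fin n) (t : ℝ) (q : EvenSphere n) : EvenSphere n :=
  ⟨shearMap k t q, mem_sphere_zero_iff_norm.2 (norm_shearMap k t q)⟩

/-- The dilations scale z and x_k² + y_k² by the same factor, so they commute with the shear, and
the shear parameters add. -/
theorem shearHeight_shearMap (k : Fin n) (t t' : ℝ) (q : EvenSphere n) :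
    shearHeight k t' (shearMap k t (q : OddSpace n))
      = shearFactor k t (q : OddSpace n) * shearHeight k (t + t') (q : OddSpace n) := by
  rw [shearHeight, planeNormSq_shearMap, shearHeight]
  simp only [shearMap, shearHeight, Sum.elim_inr]
  ring

/-- The product solves the equation that defines the factor on the right, by `eq_dilationFactor`. -/
theorem shearFactor_mul_shearFactor (k : Fin n) (t t' : ℝ) (q : EvenSphere n) :
    shearFactor k t' (shearMap k t (q : OddSpace n)) * shearFactor k t (q : OddSpace n)
      = shearFactor k (t + t') (q : OddSpace n) := by
  have h1 := shearFactor_pos k t' (shearSphere k t q)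
  have h2 := shearFactor_pos k t q
  refine eq_dilationFactor (horizontalNormSq_nonneg _)
    (horizontalNormSq_add_shearHeight_pos k _ q) (mul_pos h1 h2) ?_
  have h3 := dilationFactor_equation (horizontalNormSq_nonneg _)
    (horizontalNormSq_add_shearHeight_pos k t' (shearSphere k t q))
  change shearFactor k t' (shearMap k t q) * horizontalNormSq (shearMap k t (q : OddSpace n))
    + shearFactor k t' (shearMap k t q) ^ 2 * shearHeight k t' (shearMap k t (q : OddSpace n)) ^ 2
    = 1 at h3
  rw [horizontalNormSq_shearMap, shearHeight_shearMap] at h3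
  linear_combination h3

/-- The group law: it supplies the inverse of the shear, and later the powers of Ψ_c. -/
theorem shearMap_shearMap (k : Fin n) (t t' : ℝ) (q : EvenSphere n) :
    shearMap k t' (shearMap k t (q : OddSpace n)) = shearMap k (t + t') (q : OddSpace n) := by
  have h := shearFactor_mul_shearFactor k t t' q
  have hs : √(shearFactor k t' (shearMap k t (q : OddSpace n))) * √(shearFactor k t (q : OddSpace n))
      = √(shearFactor k (t + t') (q : OddSpace n)) := by
    rw [← h]
    exact (Real.sqrt_mul (shearFactor_pos k t' (shearSphere k t q)).le _).symm
  ext j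
  rcases j with i | i | i
  · change √(shearFactor k t' (shearMap k t (q : OddSpace n)))
      * (√(shearFactor k t (q : OddSpace n)) * (q : OddSpace n) (Sum.inl i)) = _
    rw [← mul_assoc, hs]
    rfl
  · change √(shearFactor k t' (shearMap k t (q : OddSpace n)))
      * (√(shearFactor k t (q : OddSpace n)) * (q : OddSpace n) (Sum.inr (Sum.inl i))) = _
    rw [← mul_assoc, hs]
    rfl
  · change shearFactor k t' (shearMap k t (q : OddSpace n))
      * shearHeight k t' (shearMap k t (q : OddSpace n)) = _
    rw [shearHeight_shearMap, ← mul_assoc, h]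
    rfl

theorem shearMap_zero (k : Fin n) (q : EvenSphere n) :
    shearMap k 0 (q : OddSpace n) = (q : OddSpace n) := by
  have h0 : shearHeight k 0 (q : OddSpace n) = (q : OddSpace n) (Sum.inr (Sum.inr ())) := by
    simp [shearHeight]
  have h1 : shearFactor k 0 (q : OddSpace n) = 1 := by
    refine (eq_dilationFactor (horizontalNormSq_nonneg _)
      (horizontalNormSq_add_shearHeight_pos k 0 q) one_pos ?_).symm
    rw [h0]
    linarith [horizontalNormSq_add_sq q]
  ext j
  rcases j with i | i | i <;> simp [shearMap, h0, h1]

theorem contDiffAt_planeNormSq (k : Fin n) (q : OddSpace n) :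
    ContDiffAt ℝ ∞ (planeNormSq k) q := by
  unfold planeNormSq
  fun_prop

theorem contDiffAt_shearFactor (k : Fin n) {t : ℝ} {q : OddSpace n}
    (h : 0 < horizontalNormSq q + shearHeight k t q ^ 2) :
    ContDiffAt ℝ ∞ (fun a : ℝ × OddSpace n => shearFactor k a.1 a.2) (t, q) := by
  have hp : ∀ i, ContDiffAt ℝ ∞ (fun a : ℝ × OddSpace n => planeNormSq i a.2) (t, q) := fun i =>
    (contDiffAt_planeNormSq i q).comp (t, q) contDiffAt_snd
  have hW : ContDiffAt ℝ ∞ (fun a : ℝ × OddSpace n => horizontalNormSq a.2) (t, q) :=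
    ContDiffAt.sum fun i _ => hp i
  have hz : ContDiffAt ℝ ∞ (fun a : ℝ × OddSpace n => a.2 (Sum.inr (Sum.inr ()))) (t, q) := by
    fun_prop
  have hc : ContDiffAt ℝ ∞ (fun a : ℝ × OddSpace n => shearHeight k a.1 a.2) (t, q) :=
    hz.sub ((contDiffAt_fst.mul (hp k)).div_const 2)
  -- Keeps the square root in `dilationFactor` away from 0, where it is not smooth.
  have hne : horizontalNormSq q ^ 2 + 4 * shearHeight k t q ^ 2 ≠ 0 := by
    rcases (horizontalNormSq_nonneg q).eq_or_lt with h0 | h0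
    · rw [← h0] at h ⊢
      nlinarith
    · positivity
  exact contDiffAt_const.div
    (hW.add (((hW.pow 2).add (contDiffAt_const.mul (hc.pow 2))).sqrt hne))
    (dilationFactor_denom_pos (horizontalNormSq_nonneg q) h).ne'

theorem contDiffAt_shearMap (k : Fin n) {t : ℝ} {q : OddSpace n}
    (h : 0 < horizontalNormSq q + shearHeight k t q ^ 2) :
    ContDiffAt ℝ ∞ (fun a : ℝ × OddSpace n => shearMap k a.1 a.2) (t, q) := by
  have hs := contDiffAt_shearFactor k h
  have hr := hs.sqrt (dilationFactor_pos (horizontalNormSq_nonneg q) h).ne'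
  have hc : ∀ j, ContDiffAt ℝ ∞ (fun a : ℝ × OddSpace n => a.2 j) (t, q) := fun j => by fun_prop
  have hh : ContDiffAt ℝ ∞ (fun a : ℝ × OddSpace n => shearHeight k a.1 a.2) (t, q) :=
    (hc _).sub ((contDiffAt_fst.mul
      ((contDiffAt_planeNormSq k q).comp (t, q) contDiffAt_snd)).div_const 2)
  rw [contDiffAt_euclidean]
  rintro (i | i | i)
  · exact hr.mul (hc _)
  · exact hr.mul (hc _)
  · exact hs.mul hh

theorem contMDiff_shearSphere (k : Fin n) :
    ContMDiff (𝓘(ℝ, ℝ).prod (𝓡 (2 * n))) (𝓡 (2 * n)) ∞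
      (fun a : ℝ × EvenSphere n => shearSphere k a.1 a.2) := by
  refine ContMDiff.codRestrict_sphere (n := 2 * n)
    (f := fun a : ℝ × EvenSphere n => shearMap k a.1 (a.2 : OddSpace n)) ?_
    (fun a => (shearSphere k a.1 a.2).2)
  intro a
  exact ((contDiffAt_shearMap k
    (horizontalNormSq_add_shearHeight_pos k a.1 a.2)).contMDiffAt).comp a
    (f := fun a : ℝ × EvenSphere n => ((a.1, (a.2 : OddSpace n)) : ℝ × OddSpace n))
    (contMDiffAt_fst.prodMk_space ((contMDiff_evenSphere_coe.comp contMDiff_snd) a))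

/-- `shearSphere` on the first factor of `S²ⁿ × S¹`. -/
def shearDiffeo (k : Fin n) (t : ℝ) : DiffGroup (sphereCircleModel n) (SphereCircle n) where
  toFun p := (shearSphere k t p.1, p.2)
  invFun p := (shearSphere k (-t) p.1, p.2)
  left_inv p := Prod.ext (Subtype.ext (by
    change shearMap k (-t) (shearMap k t (p.1 : OddSpace n)) = p.1
    rw [shearMap_shearMap, add_neg_cancel, shearMap_zero])) rfl
  right_inv p := Prod.ext (Subtype.ext (by
    change shearMap k t (shearMap k (-t) (p.1 : OddSpace n)) = p.1
    rw [shearMap_shearMap, neg_add_cancel, shearMap_zero])) rfl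
  contMDiff_toFun := ((contMDiff_shearSphere k).comp
    (contMDiff_const.prodMk contMDiff_fst)).prodMk contMDiff_snd
  contMDiff_invFun := ((contMDiff_shearSphere k).comp
    (contMDiff_const.prodMk contMDiff_fst)).prodMk contMDiff_snd

theorem shearDiffeo_zero (k : Fin n) : shearDiffeo k 0 = 1 :=
  Diffeomorph.ext fun p => Prod.ext (Subtype.ext (shearMap_zero k p.1)) rfl

theorem contMDiff_rotation_mul_shear (k : Fin n) :
    ContMDiff (𝓘(ℝ, ℝ).prod (sphereCircleModel n)) (sphereCircleModel n) ∞
      (fun a : ℝ × SphereCircle n => (rotationDiffeo k * shearDiffeo k a.1) a.2) := by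
  refine (rotationDiffeo k).contMDiff.comp
    (g := rotationDiffeo k) (f := fun a : ℝ × SphereCircle n => shearDiffeo k a.1 a.2) ?_
  exact ((contMDiff_shearSphere k).comp
    (contMDiff_fst.prodMk (contMDiff_fst.comp contMDiff_snd))).prodMk
    (contMDiff_snd.comp contMDiff_snd)

end Shear

/-! ### The contactomorphism Ψ_c -/

section Contactomorphism

theorem sum_eq_sum_add_sub {ι : Type*} [Fintype ι] [DecidableEq ι] {k : ι} {f g : ι → ℝ}
    (hfg : ∀ i, i ≠ k → f i = g i) : ∑ i, f i = ∑ i, g i + (f k - g k) := by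
  rw [← Finset.add_sum_erase _ f (Finset.mem_univ k),
    ← Finset.add_sum_erase _ g (Finset.mem_univ k),
    Finset.sum_congr rfl fun i hi => hfg i (Finset.ne_of_mem_erase hi)]
  ring

variable {n : ℕ}

theorem contactForm_apply (p : SphereCircle n) (v : TangentSpace (sphereCircleModel n) p) :
    contactForm p v = ambientForm (p.1 : OddSpace n) (coordDifferential p v) := rfl

/-- A diffeomorphism preserves `ξ` if it multiplies `α` by a nowhere zero function. -/
theorem preservesField_of_contactForm (f : DiffGroup (sphereCircleModel n) (SphereCircle n))
    (κ : SphereCircle n → ℝ) (hκ : ∀ p, κ p ≠ 0)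
    (h : ∀ p (v : TangentSpace (sphereCircleModel n) p),
      contactForm (f p) (mfderiv (sphereCircleModel n) (sphereCircleModel n) f p v)
        = κ p * contactForm p v) : PreservesField (contactStructure n) f := by
  intro p
  apply le_antisymm
  · rintro _ ⟨v, hv, rfl⟩
    have hv : contactForm p v = 0 := hv
    change contactForm (f p) (mfderiv (sphereCircleModel n) (sphereCircleModel n) f p v) = 0
    rw [h, hv, mul_zero]
  · intro w hw
    have hw : contactForm (f p) w = 0 := hw
    have h1 := DFunLike.congr_fun (DiffGroup.mfderiv_comp_symm f p) w
    set v : TangentSpace (sphereCircleModel n) p :=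
      mfderiv (sphereCircleModel n) (sphereCircleModel n) f.symm (f p) w with hv
    have h1 : mfderiv (sphereCircleModel n) (sphereCircleModel n) f p v = w := h1
    refine ⟨v, ?_, h1⟩
    have h2 := h p v
    rw [h1, hw] at h2
    exact (mul_eq_zero.1 h2.symm).resolve_left (hκ p)

/-- The coordinates of the differential of a map of the form `(q, u) ↦ (G (q, u), u)`. -/
theorem coordDifferential_mfderiv {f : DiffGroup (sphereCircleModel n) (SphereCircle n)}
    {G : OddSpace n × ℂ → OddSpace n} (hf1 : ∀ p, ((f p).1 : OddSpace n) = G (p.1, p.2))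
    (hf2 : ∀ p, (f p).2 = p.2) {p : SphereCircle n}
    (hG : DifferentiableAt ℝ G (p.1, p.2)) (v : TangentSpace (sphereCircleModel n) p) :
    coordDifferential (f p) (mfderiv (sphereCircleModel n) (sphereCircleModel n) f p v)
      = (fderiv ℝ G (p.1, p.2) ((coordDifferential p v).1,
          (coordDifferential p v).2 * (Complex.I * p.2)), (coordDifferential p v).2) := by
  have hf := f.mdifferentiable (by simp) p
  have e1 := mfderiv_comp (I := sphereCircleModel n) (I' := sphereCircleModel n)
    (I'' := 𝓘(ℝ, OddSpace n)) p (f := f) (g := fun q : SphereCircle n => (q.1 : OddSpace n))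
    (((contMDiff_evenSphere_coe.comp contMDiff_fst) _).mdifferentiableAt (by simp)) hf
  have e2 := mfderiv_comp (I := sphereCircleModel n) (I' := sphereCircleModel n)
    (I'' := 𝓘(ℝ, ℂ)) p (f := f) (g := fun q : SphereCircle n => (q.2 : ℂ))
    (((contMDiff_circle_coe.comp contMDiff_snd) _).mdifferentiableAt (by simp)) hf
  have hc1 : (fun q : SphereCircle n => (q.1 : OddSpace n)) ∘ f
      = G ∘ fun q : SphereCircle n => ((q.1 : OddSpace n), (q.2 : ℂ)) := funext hf1
  have hc2 : (fun q : SphereCircle n => (q.2 : ℂ)) ∘ f = fun q : SphereCircle n => (q.2 : ℂ) :=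
    funext fun q => congrArg _ (hf2 q)
  have d1 : MDifferentiableAt (sphereCircleModel n) 𝓘(ℝ, OddSpace n)
      (fun q : SphereCircle n => (q.1 : OddSpace n)) p :=
    ((contMDiff_evenSphere_coe.comp contMDiff_fst) _).mdifferentiableAt (by simp)
  have d2 : MDifferentiableAt (sphereCircleModel n) 𝓘(ℝ, ℂ)
      (fun q : SphereCircle n => (q.2 : ℂ)) p :=
    ((contMDiff_circle_coe.comp contMDiff_snd) _).mdifferentiableAt (by simp)
  have e3 : mfderiv (sphereCircleModel n) 𝓘(ℝ, OddSpace n)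
      (G ∘ fun q : SphereCircle n => ((q.1 : OddSpace n), (q.2 : ℂ))) p v
      = fderiv ℝ G (p.1, p.2) (mfderiv (sphereCircleModel n) 𝓘(ℝ, OddSpace n)
          (fun q : SphereCircle n => (q.1 : OddSpace n)) p v,
        mfderiv (sphereCircleModel n) 𝓘(ℝ, ℂ) (fun q : SphereCircle n => (q.2 : ℂ)) p v) := by
    have h : HasMFDerivAt (sphereCircleModel n) 𝓘(ℝ, OddSpace n × ℂ)
        (fun q : SphereCircle n => ((q.1 : OddSpace n), (q.2 : ℂ))) p
        ((mfderiv (sphereCircleModel n) 𝓘(ℝ, OddSpace n)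
          (fun q : SphereCircle n => (q.1 : OddSpace n)) p).prod
        (mfderiv (sphereCircleModel n) 𝓘(ℝ, ℂ) (fun q : SphereCircle n => (q.2 : ℂ)) p)) :=
      ⟨d1.continuousAt.prodMk d2.continuousAt, d1.hasMFDerivAt.2.prodMk d2.hasMFDerivAt.2⟩
    exact DFunLike.congr_fun ((hG.hasFDerivAt.hasMFDerivAt.comp p h).mfderiv) v
  have k2 : (mfderiv (sphereCircleModel n) 𝓘(ℝ, ℂ) (fun q : SphereCircle n => (q.2 : ℂ)) p v : ℂ)
      = ((coordDifferential p v).2 : ℂ) * (Complex.I * (p.2 : ℂ)) := by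
    have h := mfderiv_comp (I := sphereCircleModel n) (I' := 𝓡 1) (I'' := 𝓘(ℝ, ℂ)) p
      (f := Prod.snd) (g := fun u : Circle => (u : ℂ))
      ((contMDiff_circle_coe _).mdifferentiableAt (by simp)) mdifferentiableAt_snd
    rw [mfderiv_snd] at h
    refine (DFunLike.congr_fun h v).trans ?_
    rw [coordDifferential_apply]
    exact circleDifferential_eq p.2 v.2
  refine Prod.ext ?_ ?_
  · refine (DFunLike.congr_fun e1 v).symm.trans ?_
    rw [hc1]
    refine e3.trans ?_
    rw [k2]
    rfl
  · rw [hc2] at e2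
    have e4 := DFunLike.congr_fun e2 v
    -- `(f p).2` equals `p.2` only propositionally; the base point of dθ is moved here.
    have e5 : ∀ u : Circle, u = p.2 → ∀ w : ℂ,
        w = (mfderiv (sphereCircleModel n) 𝓘(ℝ, ℂ) (fun q : SphereCircle n => (q.2 : ℂ)) p v : ℂ) →
        ((starRingEnd ℂ) (u : ℂ) * w).im = (coordDifferential p v).2 := by
      rintro u rfl w rfl
      rfl
    exact e5 _ (hf2 p) _ e4.symm

/-- The coordinates of the differential of a map of the form `(q, u) ↦ (G (q, u), u)`, as
derivatives along a line. -/
theorem coordDifferential_mfderiv_eq {f : DiffGroup (sphereCircleModel n) (SphereCircle n)}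
    {G : OddSpace n × ℂ → OddSpace n} (hf1 : ∀ p, ((f p).1 : OddSpace n) = G (p.1, p.2))
    (hf2 : ∀ p, (f p).2 = p.2) {p : SphereCircle n}
    (hG : DifferentiableAt ℝ G (p.1, p.2)) (v : TangentSpace (sphereCircleModel n) p)
    {j : Fin n ⊕ Fin n ⊕ Unit} {d : ℝ}
    (hd : HasDerivAt (fun t : ℝ => G ((p.1 : OddSpace n) + t • (coordDifferential p v).1,
      (p.2 : ℂ) + t * ((coordDifferential p v).2 * (Complex.I * p.2))) j) d 0) :
    (coordDifferential (f p)
      (mfderiv (sphereCircleModel n) (sphereCircleModel n) f p v)).1 j = d := by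
  rw [coordDifferential_mfderiv hf1 hf2 hG]
  generalize (coordDifferential p v) = w at hd ⊢
  have h1 : HasDerivAt (fun t : ℝ => (((p.1 : OddSpace n), (p.2 : ℂ)) : OddSpace n × ℂ)
      + t • (w.1, w.2 * (Complex.I * p.2))) (w.1, w.2 * (Complex.I * p.2)) 0 := by
    simpa using ((hasDerivAt_id (0 : ℝ)).smul_const
      ((w.1, w.2 * (Complex.I * p.2)) : OddSpace n × ℂ)).const_add
      (((p.1 : OddSpace n), (p.2 : ℂ)) : OddSpace n × ℂ)
  have h2 : HasFDerivAt G (fderiv ℝ G (p.1, p.2)) ((((p.1 : OddSpace n), (p.2 : ℂ)) : OddSpace n × ℂ)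
      + (0 : ℝ) • (w.1, w.2 * (Complex.I * p.2))) := by
    simpa using hG.hasFDerivAt
  have h3 := (EuclideanSpace.proj (𝕜 := ℝ) j : OddSpace n →L[ℝ] ℝ).hasFDerivAt.comp_hasDerivAt 0
    (h2.comp_hasDerivAt 0 h1)
  refine h3.unique ?_
  refine hd.congr_of_eventuallyEq (Filter.Eventually.of_forall fun t => ?_)
  simp

theorem hasDerivAt_add_mul_const (a b : ℝ) : HasDerivAt (fun t : ℝ => a + t * b) b 0 := by
  simpa using ((hasDerivAt_id (0 : ℝ)).mul_const b).const_add a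

/-- `Ψ^* α = α + (x_k² + y_k²) dθ`. -/
theorem contactForm_rotationDiffeo (k : Fin n) (p : SphereCircle n)
    (v : TangentSpace (sphereCircleModel n) p) :
    contactForm (rotationDiffeo k p)
      (mfderiv (sphereCircleModel n) (sphereCircleModel n) (rotationDiffeo k) p v)
      = contactForm p v + planeNormSq k (p.1 : OddSpace n) * (coordDifferential p v).2 := by
  have hG : Differentiable ℝ (fun a : OddSpace n × ℂ => planeRotation k a.2 a.1) :=
    ((contDiff_planeRotation k).comp (contDiff_snd.prodMk contDiff_fst)).differentiable (by simp)
  have hf1 : ∀ p : SphereCircle n, ((rotationDiffeo k p).1 : OddSpace n)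
      = (fun a : OddSpace n × ℂ => planeRotation k a.2 a.1) (p.1, p.2) := fun _ => rfl
  have hf2 : ∀ p : SphereCircle n, (rotationDiffeo k p).2 = p.2 := fun _ => rfl
  have hu : (p.2 : ℂ).re * (p.2 : ℂ).re + (p.2 : ℂ).im * (p.2 : ℂ).im = 1 := by
    have h := Circle.normSq_coe p.2
    rwa [Complex.normSq_apply] at h
  have hθ : (coordDifferential (rotationDiffeo k p)
      (mfderiv (sphereCircleModel n) (sphereCircleModel n) (rotationDiffeo k) p v)).2
      = (coordDifferential p v).2 := by rw [coordDifferential_mfderiv hf1 hf2 (hG _)]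
  have key := fun j d => coordDifferential_mfderiv_eq hf1 hf2 (hG (p.1, p.2)) v (j := j) (d := d)
  rw [contactForm_apply, contactForm_apply]
  generalize coordDifferential (rotationDiffeo k p)
    (mfderiv (sphereCircleModel n) (sphereCircleModel n) (rotationDiffeo k) p v) = W at hθ key ⊢
  generalize coordDifferential p v = w at hθ key ⊢
  have hX : ∀ i, i ≠ k → W.1 (Sum.inl i) = w.1 (Sum.inl i) := fun i hi => key _ _
    ((hasDerivAt_add_mul_const ((p.1 : OddSpace n) (Sum.inl i)) _).congr_of_eventuallyEq
      (Filter.Eventually.of_forall fun t => by simp [planeRotation, hi]))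
  have hY : ∀ i, i ≠ k → W.1 (Sum.inr (Sum.inl i)) = w.1 (Sum.inr (Sum.inl i)) :=
    fun i hi => key _ _
      ((hasDerivAt_add_mul_const ((p.1 : OddSpace n) (Sum.inr (Sum.inl i))) _).congr_of_eventuallyEq
        (Filter.Eventually.of_forall fun t => by simp [planeRotation, hi]))
  -- Real and imaginary part of the line u + t dθ(w) i u, the tangent direction of the circle.
  have hc : HasDerivAt (fun t : ℝ => (p.2 : ℂ).re + t * -(w.2 * (p.2 : ℂ).im))
    (-(w.2 * (p.2 : ℂ).im)) 0 := hasDerivAt_add_mul_const _ _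
  have hs : HasDerivAt (fun t : ℝ => (p.2 : ℂ).im + t * (w.2 * (p.2 : ℂ).re))
    (w.2 * (p.2 : ℂ).re) 0 := hasDerivAt_add_mul_const _ _
  have hx : HasDerivAt (fun t : ℝ => (p.1 : OddSpace n) (Sum.inl k) + t * w.1 (Sum.inl k))
    (w.1 (Sum.inl k)) 0 := hasDerivAt_add_mul_const _ _
  have hy : HasDerivAt (fun t : ℝ => (p.1 : OddSpace n) (Sum.inr (Sum.inl k))
    + t * w.1 (Sum.inr (Sum.inl k))) (w.1 (Sum.inr (Sum.inl k))) 0 := hasDerivAt_add_mul_const _ _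
  have hXk := key (Sum.inl k) _ (((hc.mul hx).sub (hs.mul hy)).congr_of_eventuallyEq
    (Filter.Eventually.of_forall fun t => by simp [planeRotation]))
  have hYk := key (Sum.inr (Sum.inl k)) _ (((hs.mul hx).add (hc.mul hy)).congr_of_eventuallyEq
    (Filter.Eventually.of_forall fun t => by simp [planeRotation]))
  rw [ambientForm_apply, ambientForm_apply, hθ]
  -- Only the summand of the rotated plane changes; |u|² = 1 then reduces the change to r² dθ.
  rw [sum_eq_sum_add_sub (k := k) (g := fun i => (p.1 : OddSpace n) (Sum.inl i) * w.1 (Sum.inr (Sum.inl i))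
    - (p.1 : OddSpace n) (Sum.inr (Sum.inl i)) * w.1 (Sum.inl i)) ?_, hXk, hYk]
  · simp only [hf1, planeRotation, planeNormSq, Sum.elim_inl, Sum.elim_inr, if_pos, zero_mul, add_zero]
    linear_combination ((p.1 : OddSpace n) (Sum.inl k) * w.1 (Sum.inr (Sum.inl k))
      - (p.1 : OddSpace n) (Sum.inr (Sum.inl k)) * w.1 (Sum.inl k)
      + w.2 * ((p.1 : OddSpace n) (Sum.inl k) ^ 2
      + (p.1 : OddSpace n) (Sum.inr (Sum.inl k)) ^ 2)) * hu
  · intro i hi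
    simp only [hX i hi, hY i hi, hf1]
    simp [planeRotation, hi]

theorem differentiableAt_shearMap_fst (k : Fin n) (t : ℝ) (p : SphereCircle n) :
    DifferentiableAt ℝ (fun a : OddSpace n × ℂ => shearMap k t a.1)
      ((p.1 : OddSpace n), (p.2 : ℂ)) :=
  ((contDiffAt_shearMap k (horizontalNormSq_add_shearHeight_pos k t p.1)).comp
    ((p.1 : OddSpace n), (p.2 : ℂ)) (f := fun a : OddSpace n × ℂ => (t, a.1))
    (contDiffAt_const.prodMk contDiffAt_fst)).differentiableAt (by simp)

theorem coordDifferential_shearDiffeo_snd (k : Fin n) (t : ℝ) (p : SphereCircle n)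
    (v : TangentSpace (sphereCircleModel n) p) :
    (coordDifferential (shearDiffeo k t p)
      (mfderiv (sphereCircleModel n) (sphereCircleModel n) (shearDiffeo k t) p v)).2
      = (coordDifferential p v).2 := by
  rw [coordDifferential_mfderiv (G := fun a : OddSpace n × ℂ => shearMap k t a.1)
    (fun _ => rfl) (fun _ => rfl) (differentiableAt_shearMap_fst k t p)]

/-- The shear multiplies `α + t (x_k² + y_k²) dθ` by a positive function. -/
theorem contactForm_shearDiffeo (k : Fin n) (t : ℝ) (p : SphereCircle n)
    (v : TangentSpace (sphereCircleModel n) p) :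
    contactForm (shearDiffeo k t p)
      (mfderiv (sphereCircleModel n) (sphereCircleModel n) (shearDiffeo k t) p v)
      = shearFactor k t (p.1 : OddSpace n) * (contactForm p v
        - t * planeNormSq k (p.1 : OddSpace n) * (coordDifferential p v).2) := by
  have hpos := horizontalNormSq_add_shearHeight_pos k t p.1
  have hG := differentiableAt_shearMap_fst k t p
  have hf1 : ∀ p : SphereCircle n, ((shearDiffeo k t p).1 : OddSpace n)
      = (fun a : OddSpace n × ℂ => shearMap k t a.1) (p.1, p.2) := fun _ => rfl
  have hf2 : ∀ p : SphereCircle n, (shearDiffeo k t p).2 = p.2 := fun _ => rfl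
  have hθ := coordDifferential_shearDiffeo_snd k t p v
  have key := fun j d => coordDifferential_mfderiv_eq hf1 hf2 hG v (j := j) (d := d)
  rw [contactForm_apply, contactForm_apply]
  generalize coordDifferential (shearDiffeo k t p)
    (mfderiv (sphereCircleModel n) (sphereCircleModel n) (shearDiffeo k t) p v) = W at hθ key ⊢
  generalize coordDifferential p v = w at hθ key ⊢
  have hr : DifferentiableAt ℝ
      (fun s : ℝ => √(shearFactor k t ((p.1 : OddSpace n) + s • w.1))) 0 := by
    have h1 : ContDiffAt ℝ ∞ (fun a : ℝ × OddSpace n => √(shearFactor k a.1 a.2))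
        (t, (p.1 : OddSpace n) + (0 : ℝ) • w.1) := by
      rw [zero_smul, add_zero]
      exact (contDiffAt_shearFactor k hpos).sqrt (shearFactor_pos k t p.1).ne'
    exact (h1.comp (0 : ℝ) (f := fun s : ℝ => (t, (p.1 : OddSpace n) + s • w.1))
      (by fun_prop)).differentiableAt (by simp)
  -- The derivative of √s need not be known: it moves (x_i, y_i) radially, and x_i dy_i - y_i dx_i
  -- vanishes on radial vectors. No dz occurs in λ, so the z-coordinate needs no derivative at all.
  obtain ⟨ρ, hρ⟩ : ∃ ρ, HasDerivAt
    (fun s : ℝ => √(shearFactor k t ((p.1 : OddSpace n) + s • w.1))) ρ 0 := ⟨_, hr.hasDerivAt⟩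
  have hW : ∀ j, (∀ q : OddSpace n, shearMap k t q j = √(shearFactor k t q) * q j) →
      W.1 j = ρ * (p.1 : OddSpace n) j + √(shearFactor k t (p.1 : OddSpace n)) * w.1 j := by
    intro j hj
    refine key _ _ ?_
    have h1 := hρ.mul (hasDerivAt_add_mul_const ((p.1 : OddSpace n) j) (w.1 j))
    simp only [zero_smul, add_zero, zero_mul] at h1
    refine h1.congr_of_eventuallyEq (Filter.Eventually.of_forall fun s => ?_)
    change shearMap k t ((p.1 : OddSpace n) + s • w.1) j = _
    rw [hj]
    simp
  have hsq := Real.mul_self_sqrt (shearFactor_pos k t p.1).le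
  rw [ambientForm_apply, ambientForm_apply, hθ]
  have h1 : ∀ i : Fin n, ((shearDiffeo k t p).1 : OddSpace n) (Sum.inl i)
      * W.1 (Sum.inr (Sum.inl i)) - ((shearDiffeo k t p).1 : OddSpace n) (Sum.inr (Sum.inl i))
      * W.1 (Sum.inl i) = shearFactor k t (p.1 : OddSpace n)
        * ((p.1 : OddSpace n) (Sum.inl i) * w.1 (Sum.inr (Sum.inl i))
        - (p.1 : OddSpace n) (Sum.inr (Sum.inl i)) * w.1 (Sum.inl i)) := by
    intro i
    rw [hW (Sum.inl i) fun _ => rfl, hW (Sum.inr (Sum.inl i)) fun _ => rfl]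
    change √(shearFactor k t (p.1 : OddSpace n)) * (p.1 : OddSpace n) (Sum.inl i) * _
      - √(shearFactor k t (p.1 : OddSpace n)) * (p.1 : OddSpace n) (Sum.inr (Sum.inl i)) * _ = _
    linear_combination ((p.1 : OddSpace n) (Sum.inl i) * w.1 (Sum.inr (Sum.inl i))
        - (p.1 : OddSpace n) (Sum.inr (Sum.inl i)) * w.1 (Sum.inl i)) * hsq
  simp only [h1]
  rw [← Finset.mul_sum]
  change _ + 2 * (shearFactor k t (p.1 : OddSpace n) * ((p.1 : OddSpace n) (Sum.inr (Sum.inr ()))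
    - t * planeNormSq k (p.1 : OddSpace n) / 2)) * w.2 = _
  ring

/-- `Ψ`, composed with a shear, is a contactomorphism. -/
def rotationContactomorphism (k : Fin n) : ContactDiffGroup (contactStructure n) :=
  ⟨rotationDiffeo k * shearDiffeo k 1, by
    refine preservesField_of_contactForm _ (fun p => shearFactor k 1 (p.1 : OddSpace n))
      (fun p => (shearFactor_pos k 1 p.1).ne') fun p v => ?_
    have h1 : mfderiv (sphereCircleModel n) (sphereCircleModel n)
        (rotationDiffeo k * shearDiffeo k 1 : DiffGroup (sphereCircleModel n) (SphereCircle n)) p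
        = (mfderiv (sphereCircleModel n) (sphereCircleModel n) (rotationDiffeo k)
          (shearDiffeo k 1 p)).comp
          (mfderiv (sphereCircleModel n) (sphereCircleModel n) (shearDiffeo k 1) p) :=
      mfderiv_comp p ((rotationDiffeo k).mdifferentiable (by simp) (shearDiffeo k 1 p))
        ((shearDiffeo k 1).mdifferentiable (by simp) p)
    rw [h1]
    refine (contactForm_rotationDiffeo k (shearDiffeo k 1 p)
      (mfderiv (sphereCircleModel n) (sphereCircleModel n) (shearDiffeo k 1) p v)).trans ?_
    have hθ : (coordDifferential (shearDiffeo k 1 p)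
        (mfderiv (sphereCircleModel n) (sphereCircleModel n) (shearDiffeo k 1) p v)).2
        = (coordDifferential p v).2 := coordDifferential_shearDiffeo_snd k 1 p v
    -- The error of Ψ at the sheared point is s r² dθ, which cancels the one in s(α - r² dθ)
    -- exactly.
    have hr : planeNormSq k ((shearDiffeo k 1 p).1 : OddSpace n)
        = shearFactor k 1 (p.1 : OddSpace n) * planeNormSq k (p.1 : OddSpace n) :=
      planeNormSq_shearMap k k 1 p.1
    rw [contactForm_shearDiffeo, hθ, hr]
    ring⟩

end Contactomorphism

/-! ### Ψ² is smoothly trivial in π₀ -/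

section SmoothTriviality

variable {n : ℕ}

/-- The rotation by the angle `t` of the plane of the coordinates `(y_k, z)`. -/
def tiltMap (k : Fin n) (t : ℝ) (q : OddSpace n) : OddSpace n :=
  WithLp.toLp 2 (Sum.elim (fun i => q (Sum.inl i))
    (Sum.elim
      (fun i => if i = k then Real.cos t * q (Sum.inr (Sum.inl k))
        - Real.sin t * q (Sum.inr (Sum.inr ())) else q (Sum.inr (Sum.inl i)))
      (fun _ => Real.sin t * q (Sum.inr (Sum.inl k)) + Real.cos t * q (Sum.inr (Sum.inr ())))))

theorem norm_tiltMap (k : Fin n) (t : ℝ) (q : OddSpace n) : ‖tiltMap k t q‖ = ‖q‖ := by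
  refine (sq_eq_sq₀ (norm_nonneg _) (norm_nonneg _)).1 ?_
  rw [norm_sq_oddSpace, norm_sq_oddSpace, horizontalNormSq, horizontalNormSq,
    sum_eq_sum_add_sub (k := k) (g := fun i => planeNormSq i q)]
  · simp only [planeNormSq, tiltMap, Sum.elim_inl, Sum.elim_inr, if_pos]
    linear_combination (q (Sum.inr (Sum.inl k)) ^ 2 + q (Sum.inr (Sum.inr ())) ^ 2)
      * Real.sin_sq_add_cos_sq t
  · intro i hi
    simp [planeNormSq, tiltMap, hi]

theorem tiltMap_tiltMap_neg (k : Fin n) (t : ℝ) (q : OddSpace n) :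
    tiltMap k t (tiltMap k (-t) q) = q := by
  have h := Real.sin_sq_add_cos_sq t
  ext j
  rcases j with i | i | i
  · rfl
  · by_cases hi : i = k
    · subst hi
      simp only [tiltMap, Sum.elim_inl, Sum.elim_inr, if_pos, Real.cos_neg, Real.sin_neg]
      linear_combination q (Sum.inr (Sum.inl i)) * h
    · simp [tiltMap, hi]
  · simp only [tiltMap, Sum.elim_inl, Sum.elim_inr, if_pos, Real.cos_neg, Real.sin_neg]
    linear_combination q (Sum.inr (Sum.inr ())) * h

theorem contDiff_tiltMap (k : Fin n) :
    ContDiff ℝ ∞ fun a : ℝ × OddSpace n => tiltMap k a.1 a.2 := by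
  have hc : ∀ j, ContDiff ℝ ∞ fun a : ℝ × OddSpace n => a.2 j := fun j => by fun_prop
  have hcos : ContDiff ℝ ∞ fun a : ℝ × OddSpace n => Real.cos a.1 := contDiff_fst.cos
  have hsin : ContDiff ℝ ∞ fun a : ℝ × OddSpace n => Real.sin a.1 := contDiff_fst.sin
  rw [contDiff_euclidean]
  rintro (i | i | i)
  · exact hc _
  · by_cases hi : i = k
    · simpa [tiltMap, hi] using (hcos.mul (hc _)).sub (hsin.mul (hc _))
    · simpa [tiltMap, hi] using hc (Sum.inr (Sum.inl i))
  · exact (hsin.mul (hc _)).add (hcos.mul (hc _))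

/-- `tiltMap` as a map of the sphere. -/
def tiltSphere (k : Fin n) (t : ℝ) (q : EvenSphere n) : EvenSphere n :=
  ⟨tiltMap k t q, mem_sphere_zero_iff_norm.2
    ((norm_tiltMap k t q).trans (mem_sphere_zero_iff_norm.1 q.2))⟩

theorem contMDiff_tiltSphere (k : Fin n) :
    ContMDiff (𝓘(ℝ, ℝ).prod (𝓡 (2 * n))) (𝓡 (2 * n)) ∞
      (fun a : ℝ × EvenSphere n => tiltSphere k a.1 a.2) :=
  ContMDiff.codRestrict_sphere (n := 2 * n)
    (f := fun a : ℝ × EvenSphere n => tiltMap k a.1 (a.2 : OddSpace n))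
    ((contDiff_tiltMap k).contMDiff.comp
      (contMDiff_fst.prodMk_space (contMDiff_evenSphere_coe.comp contMDiff_snd)))
    (fun a => (tiltSphere k a.1 a.2).2)

/-- `tiltSphere` on the first factor of `S²ⁿ × S¹`. -/
def tiltDiffeo (k : Fin n) (t : ℝ) : DiffGroup (sphereCircleModel n) (SphereCircle n) where
  toFun p := (tiltSphere k t p.1, p.2)
  invFun p := (tiltSphere k (-t) p.1, p.2)
  left_inv p := Prod.ext (Subtype.ext (by
    have h := tiltMap_tiltMap_neg k (-t) (p.1 : OddSpace n)
    rwa [neg_neg] at h)) rfl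
  right_inv p := Prod.ext (Subtype.ext (tiltMap_tiltMap_neg k t p.1)) rfl
  contMDiff_toFun := ((contMDiff_tiltSphere k).comp
    (contMDiff_const.prodMk contMDiff_fst)).prodMk contMDiff_snd
  contMDiff_invFun := ((contMDiff_tiltSphere k).comp
    (contMDiff_const.prodMk contMDiff_fst)).prodMk contMDiff_snd

theorem joined_one_tiltDiffeo_pi (k : Fin n) : Joined 1 (tiltDiffeo k Real.pi) := by
  have h1 : SmoothlyIsotopic (tiltDiffeo k (0 * Real.pi)) (tiltDiffeo k (1 * Real.pi)) := by
    refine SmoothlyIsotopic.of_real (Φ := fun t => tiltDiffeo k (t * Real.pi)) ?_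
    refine ContMDiff.prodMk ?_ (contMDiff_snd.comp contMDiff_snd)
    refine (contMDiff_tiltSphere k).comp (f := fun a : ℝ × SphereCircle n =>
      ((a.1 * Real.pi, a.2.1) : ℝ × EvenSphere n)) ?_
    refine ContMDiff.prodMk ?_ (contMDiff_fst.comp contMDiff_snd)
    exact (contDiff_id.mul contDiff_const).contMDiff.comp contMDiff_fst
  have h2 : tiltDiffeo k (0 * Real.pi) = 1 := by
    refine Diffeomorph.ext fun p => Prod.ext (Subtype.ext ?_) rfl
    change tiltMap k (0 * Real.pi) (p.1 : OddSpace n) = p.1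
    ext j
    rcases j with i | i | i
    · rfl
    · by_cases hi : i = k
      · subst hi
        simp [tiltMap]
      · simp [tiltMap, hi]
    · simp [tiltMap]
  have h3 := h1.joined
  rwa [h2, one_mul] at h3

/-- The tilt by π changes the signs of y_k and z, so it acts on the plane (x_k, y_k) as a
reflection, and a reflection conjugates a rotation to its inverse. -/
theorem tiltDiffeo_pi_mul_rotationDiffeo (k : Fin n) :
    tiltDiffeo k Real.pi * rotationDiffeo k = (rotationDiffeo k)⁻¹ * tiltDiffeo k Real.pi := by
  refine Diffeomorph.ext fun p => Prod.ext (Subtype.ext ?_) rfl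
  change tiltMap k Real.pi (planeRotation k (p.2 : ℂ) (p.1 : OddSpace n))
    = planeRotation k ((p.2⁻¹ : Circle) : ℂ) (tiltMap k Real.pi p.1)
  ext j
  rcases j with i | i | i
  · by_cases hi : i = k
    · subst hi
      simp [tiltMap, planeRotation]
    · simp [tiltMap, planeRotation, hi]
  · by_cases hi : i = k
    · subst hi
      simp [tiltMap, planeRotation]
      ring
    · simp [tiltMap, planeRotation, hi]
  · simp [tiltMap, planeRotation]

/-- The tilt by π has trivial class, so the conjugation relation reads [Ψ] = [Ψ]⁻¹. -/
theorem mk_rotationDiffeo_sq (k : Fin n) : PiZero.mk (rotationDiffeo k) ^ 2 = 1 := by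
  have h1 : PiZero.mk (tiltDiffeo k Real.pi) = 1 := by
    rw [← map_one PiZero.mk]
    exact ((PiZero.mk_eq_mk_iff _ _).2 (joined_one_tiltDiffeo_pi k)).symm
  have h2 := congrArg PiZero.mk (tiltDiffeo_pi_mul_rotationDiffeo k)
  rw [map_mul, map_mul, h1, one_mul, mul_one, map_inv] at h2
  rw [sq, mul_eq_one_iff_eq_inv]
  exact h2

theorem smoothlyIsotopic_rotationContactomorphism (k : Fin n) :
    SmoothlyIsotopic (rotationDiffeo k)
      (rotationContactomorphism k : DiffGroup (sphereCircleModel n) (SphereCircle n)) := by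
  have h := SmoothlyIsotopic.of_real (Φ := fun t => rotationDiffeo k * shearDiffeo k t)
    (contMDiff_rotation_mul_shear k)
  rwa [shearDiffeo_zero, mul_one] at h

theorem mk_rotationContactomorphism_sq_mem_ker (k : Fin n) :
    PiZero.mk (rotationContactomorphism k ^ 2) ∈ (piZeroInclusion (contactStructure n)).ker := by
  have h : PiZero.mk (rotationDiffeo k)
      = PiZero.mk (rotationContactomorphism k : DiffGroup (sphereCircleModel n) (SphereCircle n)) :=
    (PiZero.mk_eq_mk_iff _ _).2 (smoothlyIsotopic_rotationContactomorphism k).joined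
  have h2 := mk_rotationDiffeo_sq k
  rw [h, ← map_pow] at h2
  exact h2

end SmoothTriviality

/-! ### The Lagrangian frame of a parametrised Legendrian -/

section LegendrianFrame

open Matrix

variable {X : Type*} [NormedAddCommGroup X] [NormedSpace ℝ X]

/-- The form `g dh - h dg`, evaluated at `v`. -/
def pairForm (g h : X → ℝ) (v x : X) : ℝ := g x * fderiv ℝ h x v - h x * fderiv ℝ g x v

theorem contDiff_pairForm {g h : X → ℝ} (hg : ContDiff ℝ ∞ g) (hh : ContDiff ℝ ∞ h) (v : X) :
    ContDiff ℝ ∞ (pairForm g h v) :=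
  (hg.mul ((hh.fderiv_right (m := ∞) (by simp)).clm_apply contDiff_const)).sub
    (hh.mul ((hg.fderiv_right (m := ∞) (by simp)).clm_apply contDiff_const))

/-- `d (g dh - h dg) = 2 dg ∧ dh`. -/
theorem fderiv_pairForm_sub {g h : X → ℝ} (hg : ContDiff ℝ ∞ g) (hh : ContDiff ℝ ∞ h) (x v w : X) :
    fderiv ℝ (pairForm g h v) x w - fderiv ℝ (pairForm g h w) x v
      = 2 * (fderiv ℝ g x w * fderiv ℝ h x v - fderiv ℝ h x w * fderiv ℝ g x v) := by
  have hd : ∀ {φ : X → ℝ}, ContDiff ℝ ∞ φ → ∀ a : X, HasFDerivAt (fun x => fderiv ℝ φ x a)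
      ((ContinuousLinearMap.apply ℝ ℝ a).comp (fderiv ℝ (fderiv ℝ φ) x)) x := by
    intro φ hφ a
    exact (ContinuousLinearMap.apply ℝ ℝ a).hasFDerivAt.comp x
      (((hφ.fderiv_right (m := ∞) (by simp)).differentiable (by simp)) x).hasFDerivAt
  have hp : ∀ a b : X, fderiv ℝ (pairForm g h a) x b
      = g x * fderiv ℝ (fderiv ℝ h) x b a + fderiv ℝ g x b * fderiv ℝ h x a
        - (h x * fderiv ℝ (fderiv ℝ g) x b a + fderiv ℝ h x b * fderiv ℝ g x a) := by
    intro a b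
    have h1 := (((hg.differentiable (by simp)) x).hasFDerivAt.mul (hd hh a)).sub
      (((hh.differentiable (by simp)) x).hasFDerivAt.mul (hd hg a))
    have h2 := DFunLike.congr_fun h1.fderiv b
    refine Eq.trans h2 ?_
    simp
    ring
  have hsg : fderiv ℝ (fderiv ℝ g) x w v = fderiv ℝ (fderiv ℝ g) x v w :=
    (hg.contDiffAt.isSymmSndFDerivAt (by
      rw [minSmoothness_of_isRCLikeNormedField]
      exact WithTop.coe_le_coe.2 le_top)) w v
  have hsh : fderiv ℝ (fderiv ℝ h) x w v = fderiv ℝ (fderiv ℝ h) x v w :=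
    (hh.contDiffAt.isSymmSndFDerivAt (by
      rw [minSmoothness_of_isRCLikeNormedField]
      exact WithTop.coe_le_coe.2 le_top)) w v
  rw [hp, hp, hsg, hsh]
  ring

variable {ι : Type*} [Fintype ι] [DecidableEq ι]

/-- The matrix with the columns `∂_j (x + i y, z + i θ)`, where `dθ = a db - b da`, and the column
`(x / 2 + i y / 2, z)`. -/
def frameMatrix (x y : ι → X → ℝ) (z a b : X → ℝ) (e : ι → X) (o : X) :
    Matrix (ι ⊕ Unit) (ι ⊕ Unit) ℂ :=
  Matrix.fromBlocks
    (Matrix.of fun i j => (fderiv ℝ (x i) o (e j) + fderiv ℝ (y i) o (e j) * Complex.I : ℂ))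
    (Matrix.of fun i _ => ((x i o / 2 : ℝ) + (y i o / 2 : ℝ) * Complex.I : ℂ))
    (Matrix.of fun _ j => (fderiv ℝ z o (e j) + pairForm a b (e j) o * Complex.I : ℂ))
    (Matrix.of fun _ _ => (z o : ℂ))

/-- An integral manifold of the contact structure, with its radial direction, spans a Lagrangian
subspace. -/
theorem det_frameMatrix_ne_zero {x y : ι → X → ℝ} {z a b : X → ℝ} {e : ι → X} {o : X}
    (hx : ∀ i, ContDiff ℝ ∞ (x i)) (hy : ∀ i, ContDiff ℝ ∞ (y i)) (hz : ContDiff ℝ ∞ z)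
    (ha : ContDiff ℝ ∞ a) (hb : ContDiff ℝ ∞ b)
    (hsphere : ∀ q, ∑ i, (x i q ^ 2 + y i q ^ 2) + z q ^ 2 = 1)
    (hcircle : ∀ q, a q ^ 2 + b q ^ 2 = 1)
    (hleg : ∀ q v, ∑ i, pairForm (x i) (y i) v q + 2 * z q * pairForm a b v q = 0)
    (hind : ∀ r : ι → ℝ, (∀ i, fderiv ℝ (x i) o (∑ j, r j • e j) = 0) →
      (∀ i, fderiv ℝ (y i) o (∑ j, r j • e j) = 0) → fderiv ℝ z o (∑ j, r j • e j) = 0 →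
      pairForm a b (∑ j, r j • e j) o = 0 → r = 0) :
    (frameMatrix x y z a b e o).det ≠ 0 := by
  have hxd := fun i => ((hx i).differentiable (by simp)) o
  have hyd := fun i => ((hy i).differentiable (by simp)) o
  have hzd := (hz.differentiable (by simp)) o
  have had := (ha.differentiable (by simp)) o
  have hbd := (hb.differentiable (by simp)) o
  have hcd : ∀ v, a o * fderiv ℝ a o v + b o * fderiv ℝ b o v = 0 := by
    intro v
    have h1 := (had.hasFDerivAt.pow 2).add (hbd.hasFDerivAt.pow 2)
    have h2 : HasFDerivAt ((a ^ 2 + b ^ 2 : X → ℝ)) (0 : X →L[ℝ] ℝ) o :=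
      (hasFDerivAt_const (1 : ℝ) o).congr_of_eventuallyEq
        (Filter.Eventually.of_forall fun q => hcircle q)
    have h3 := DFunLike.congr_fun (h1.unique h2) v
    simp at h3
    linarith
  have hsd : ∀ v, ∑ i, (x i o * fderiv ℝ (x i) o v + y i o * fderiv ℝ (y i) o v)
      + z o * fderiv ℝ z o v = 0 := by
    intro v
    have h1 := (HasFDerivAt.fun_sum (u := Finset.univ) fun i _ =>
      ((hxd i).hasFDerivAt.pow 2).add ((hyd i).hasFDerivAt.pow 2)).add (hzd.hasFDerivAt.pow 2)
    have h2 := h1.unique ((hasFDerivAt_const (1 : ℝ) o).congr_of_eventuallyEq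
        (Filter.Eventually.of_forall fun q => hsphere q))
    have h3 := DFunLike.congr_fun h2 v
    simp [mul_assoc, ← mul_add, ← Finset.mul_sum] at h3
    linarith
  -- da ∧ db = 0, because a² + b² = 1 makes da and db proportional; hence dθ = a db - b da is
  -- closed.
  have hcross : ∀ v w, fderiv ℝ a o w * fderiv ℝ b o v - fderiv ℝ b o w * fderiv ℝ a o v = 0 := by
    intro v w
    linear_combination (-(fderiv ℝ a o w * fderiv ℝ b o v - fderiv ℝ b o w * fderiv ℝ a o v))
      * hcircle o + (a o * fderiv ℝ b o v - b o * fderiv ℝ a o v) * hcd w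
      + (-a o * fderiv ℝ b o w + b o * fderiv ℝ a o w) * hcd v
  have hdleg : ∀ v w, ∑ i, fderiv ℝ (pairForm (x i) (y i) v) o w
      + 2 * (fderiv ℝ z o w * pairForm a b v o + z o * fderiv ℝ (pairForm a b v) o w) = 0 := by
    intro v w
    have h1 := (HasFDerivAt.fun_sum (u := Finset.univ) fun i _ =>
      (((contDiff_pairForm (hx i) (hy i) v).differentiable (by simp)) o).hasFDerivAt).add
      ((hzd.hasFDerivAt.const_mul 2).mul
        (((contDiff_pairForm ha hb v).differentiable (by simp)) o).hasFDerivAt)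
    have h2 := h1.unique ((hasFDerivAt_const (0 : ℝ) o).congr_of_eventuallyEq
        (Filter.Eventually.of_forall fun q => hleg q v))
    have h3 := DFunLike.congr_fun h2 w
    simp at h3
    linarith
  -- The pullback of λ vanishes identically, so its exterior derivative does too: the tangent space
  -- is isotropic for ω.
  have hiso : ∀ v w, ∑ i, (fderiv ℝ (x i) o w * fderiv ℝ (y i) o v
      - fderiv ℝ (y i) o w * fderiv ℝ (x i) o v)
      + (fderiv ℝ z o w * pairForm a b v o - fderiv ℝ z o v * pairForm a b w o) = 0 := by
    intro v w
    have h1 := hdleg v w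
    have h2 := hdleg w v
    have h3 : ∑ i, fderiv ℝ (pairForm (x i) (y i) v) o w
        - ∑ i, fderiv ℝ (pairForm (x i) (y i) w) o v
        = 2 * ∑ i, (fderiv ℝ (x i) o w * fderiv ℝ (y i) o v
          - fderiv ℝ (y i) o w * fderiv ℝ (x i) o v) := by
      rw [← Finset.sum_sub_distrib, Finset.mul_sum]
      exact Finset.sum_congr rfl fun i _ => fderiv_pairForm_sub (hx i) (hy i) o v w
    have h4 := fderiv_pairForm_sub ha hb o v w
    rw [hcross] at h4
    linear_combination (h1 - h2 - h3) / 2 - z o * h4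
  apply det_ne_zero_of_lagrangian
  · rintro (j | j) (k | k)
    · rw [← hiso (e k) (e j)]
      simp [-Complex.ofReal_div, frameMatrix, Matrix.mul_apply, Complex.im_sum]
      simp only [Finset.sum_add_distrib, Finset.sum_neg_distrib]
      ring
    · rw [← neg_eq_zero, ← zero_div 2, ← hleg o (e j)]
      simp [-Complex.ofReal_div, frameMatrix, Matrix.mul_apply, Complex.im_sum, pairForm]
      simp only [mul_comm (fderiv ℝ _ o (e j)), div_mul_eq_mul_div, Finset.sum_add_distrib,
        Finset.sum_neg_distrib, ← Finset.sum_div]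
      ring
    · rw [← zero_div 2, ← hleg o (e k)]
      simp [-Complex.ofReal_div, frameMatrix, Matrix.mul_apply, Complex.im_sum, pairForm]
      simp only [div_mul_eq_mul_div, ← neg_div, Finset.sum_add_distrib,
        Finset.sum_neg_distrib, ← Finset.sum_div]
      ring
    · simp [-Complex.ofReal_div, frameMatrix, Matrix.mul_apply, Complex.im_sum]
      exact Finset.sum_eq_zero fun i _ => by ring
  · intro r hr
    set v : X := ∑ j, r (Sum.inl j) • e j with hv
    set ρ : ℝ := r (Sum.inr ()) with hρ
    have hlin : ∀ φ : X →L[ℝ] ℝ, φ v = ∑ j, φ (e j) * r (Sum.inl j) := by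
      intro φ
      simp [hv, mul_comm]
    have e1 : ∀ i, fderiv ℝ (x i) o v + x i o / 2 * ρ = 0 := by
      intro i
      have h := congrArg Complex.re (congrFun hr (Sum.inl i))
      simpa [frameMatrix, Matrix.mulVec, dotProduct, Complex.re_sum, hlin] using h
    have e2 : ∀ i, fderiv ℝ (y i) o v + y i o / 2 * ρ = 0 := by
      intro i
      have h := congrArg Complex.im (congrFun hr (Sum.inl i))
      simpa [frameMatrix, Matrix.mulVec, dotProduct, Complex.im_sum, hlin] using h
    have e3 : fderiv ℝ z o v + z o * ρ = 0 := by
      have h := congrArg Complex.re (congrFun hr (Sum.inr ()))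
      simpa [frameMatrix, Matrix.mulVec, dotProduct, Complex.re_sum, hlin] using h
    have e4 : pairForm a b v o = 0 := by
      have h := congrArg Complex.im (congrFun hr (Sum.inr ()))
      have h5 : pairForm a b v o = ∑ j, pairForm a b (e j) o * r (Sum.inl j) := by
        simp only [pairForm, hlin, Finset.mul_sum, sub_mul, Finset.sum_sub_distrib, mul_assoc]
      rw [h5]
      simpa [frameMatrix, Matrix.mulVec, dotProduct, Complex.im_sum] using h
    have h1 : ∑ i, (x i o * fderiv ℝ (x i) o v + y i o * fderiv ℝ (y i) o v)
        = -(ρ / 2) * ∑ i, (x i o ^ 2 + y i o ^ 2) := by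
      rw [Finset.mul_sum]
      exact Finset.sum_congr rfl fun i _ => by linear_combination x i o * e1 i + y i o * e2 i
    -- Pair the relation v + ρX = 0 with N: v is tangent to the sphere, so ρ⟨N, X⟩ = 0, and ⟨N, X⟩ >
    -- 0 leaves a relation among tangent columns only.
    have h2 : ρ * ((∑ i, (x i o ^ 2 + y i o ^ 2)) / 2 + z o ^ 2) = 0 := by
      linear_combination h1 - hsd v + z o * e3
    have h3 : (∑ i, (x i o ^ 2 + y i o ^ 2)) / 2 + z o ^ 2 ≠ 0 := by
      have := hsphere o
      nlinarith [sq_nonneg (z o)]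
    have h4 : ρ = 0 := (mul_eq_zero.1 h2).resolve_right h3
    simp only [h4, mul_zero, add_zero] at e1 e2 e3
    have h5 := hind (fun j => r (Sum.inl j)) e1 e2 e3 e4
    funext j
    rcases j with j | j
    · exact congrFun h5 j
    · exact h4

end LegendrianFrame

/-! ### A Legendrian disc through the pole, and its images -/

section LegendrianDisc

variable {n : ℕ}

/-- The coordinates of `ℝ²ⁿ⁺¹`, as functions on `S²ⁿ × S¹`. -/
def sphereCoord (j : Fin n ⊕ Fin n ⊕ Unit) : C^∞⟮sphereCircleModel n, SphereCircle n; ℝ⟯ :=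
  ⟨fun p => (p.1 : OddSpace n) j,
    (EuclideanSpace.proj (𝕜 := ℝ) j : OddSpace n →L[ℝ] ℝ).contMDiff.comp
      (contMDiff_evenSphere_coe.comp contMDiff_fst)⟩

/-- The function `cos θ` on `S²ⁿ × S¹`. -/
def circleRe : C^∞⟮sphereCircleModel n, SphereCircle n; ℝ⟯ :=
  ⟨fun p => (p.2 : ℂ).re, Complex.reCLM.contMDiff.comp (contMDiff_circle_coe.comp contMDiff_snd)⟩

/-- The function `sin θ` on `S²ⁿ × S¹`. -/
def circleIm : C^∞⟮sphereCircleModel n, SphereCircle n; ℝ⟯ :=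
  ⟨fun p => (p.2 : ℂ).im, Complex.imCLM.contMDiff.comp (contMDiff_circle_coe.comp contMDiff_snd)⟩

variable {X : Type*} [NormedAddCommGroup X] [NormedSpace ℝ X]

/-- The coordinates of the velocity of a map into `S²ⁿ × S¹`. -/
theorem coordDifferential_mfderiv_param {h : X → SphereCircle n}
    (hh : ContMDiff 𝓘(ℝ, X) (sphereCircleModel n) ∞ h) (x v : X) :
    (∀ j, (coordDifferential (h x) (mfderiv 𝓘(ℝ, X) (sphereCircleModel n) h x v)).1 j
      = fderiv ℝ (fun x => sphereCoord j (h x)) x v) ∧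
    (coordDifferential (h x) (mfderiv 𝓘(ℝ, X) (sphereCircleModel n) h x v)).2
      = pairForm (fun x => circleRe (h x)) (fun x => circleIm (h x)) v x := by
  have hd := (hh x).mdifferentiableAt (by simp)
  have d1 : MDifferentiableAt (sphereCircleModel n) 𝓘(ℝ, OddSpace n)
      (fun q : SphereCircle n => (q.1 : OddSpace n)) (h x) :=
    ((contMDiff_evenSphere_coe.comp contMDiff_fst) _).mdifferentiableAt (by simp)
  have d2 : MDifferentiableAt (sphereCircleModel n) 𝓘(ℝ, ℂ)
      (fun q : SphereCircle n => (q.2 : ℂ)) (h x) :=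
    ((contMDiff_circle_coe.comp contMDiff_snd) _).mdifferentiableAt (by simp)
  have e1 := DFunLike.congr_fun (mfderiv_comp x d1 hd) v
  have e2 := DFunLike.congr_fun (mfderiv_comp x d2 hd) v
  have f1 : DifferentiableAt ℝ (fun x => ((h x).1 : OddSpace n)) x :=
    (((contMDiff_evenSphere_coe.comp contMDiff_fst).comp hh).contDiff.differentiable (by simp)) x
  have f2 : DifferentiableAt ℝ (fun x => ((h x).2 : ℂ)) x :=
    (((contMDiff_circle_coe.comp contMDiff_snd).comp hh).contDiff.differentiable (by simp)) x
  rw [mfderiv_eq_fderiv] at e1 e2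
  constructor
  · intro j
    have h1 := DFunLike.congr_fun (((EuclideanSpace.proj (𝕜 := ℝ) j :
      OddSpace n →L[ℝ] ℝ).hasFDerivAt.comp x f1.hasFDerivAt).fderiv) v
    exact (congrArg (fun w : OddSpace n => w j) e1).symm.trans h1.symm
  · have h1 := DFunLike.congr_fun ((Complex.reCLM.hasFDerivAt.comp x f2.hasFDerivAt).fderiv) v
    have h2 := DFunLike.congr_fun ((Complex.imCLM.hasFDerivAt.comp x f2.hasFDerivAt).fderiv) v
    have h1 : fderiv ℝ (fun x => circleRe (h x)) x v
      = (fderiv ℝ (fun x => ((h x).2 : ℂ)) x v).re := h1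
    have h2 : fderiv ℝ (fun x => circleIm (h x)) x v
      = (fderiv ℝ (fun x => ((h x).2 : ℂ)) x v).im := h2
    have h3 : (coordDifferential (h x) (mfderiv 𝓘(ℝ, X) (sphereCircleModel n) h x v)).2
        = ((starRingEnd ℂ) ((h x).2 : ℂ) * fderiv ℝ (fun x => ((h x).2 : ℂ)) x v).im :=
      congrArg (fun w : ℂ => ((starRingEnd ℂ) ((h x).2 : ℂ) * w).im) e2.symm
    rw [h3, pairForm, h1, h2, Complex.mul_im, Complex.conj_re, Complex.conj_im]
    change (h x).2.val.re * _ + -(h x).2.val.im * _ = (h x).2.val.re * _ - (h x).2.val.im * _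
    ring

/-- Expresses α through coordinate functions of the parameter alone, the form in which
`det_frameMatrix_ne_zero` takes the Legendrian condition. -/
theorem contactForm_mfderiv_param {h : X → SphereCircle n}
    (hh : ContMDiff 𝓘(ℝ, X) (sphereCircleModel n) ∞ h) (x v : X) :
    contactForm (h x) (mfderiv 𝓘(ℝ, X) (sphereCircleModel n) h x v)
      = ∑ i : Fin n, pairForm (fun x => sphereCoord (Sum.inl i) (h x))
          (fun x => sphereCoord (Sum.inr (Sum.inl i)) (h x)) v x
        + 2 * sphereCoord (Sum.inr (Sum.inr ())) (h x)
          * pairForm (fun x => circleRe (h x)) (fun x => circleIm (h x)) v x := by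
  obtain ⟨h1, h2⟩ := coordDifferential_mfderiv_param hh x v
  have key : ∀ W : OddSpace n × ℝ,
      (∀ j, W.1 j = fderiv ℝ (fun x => sphereCoord j (h x)) x v) →
      W.2 = pairForm (fun x => circleRe (h x)) (fun x => circleIm (h x)) v x →
      ambientForm ((h x).1 : OddSpace n) W
        = ∑ i : Fin n, pairForm (fun x => sphereCoord (Sum.inl i) (h x))
          (fun x => sphereCoord (Sum.inr (Sum.inl i)) (h x)) v x
        + 2 * sphereCoord (Sum.inr (Sum.inr ())) (h x)
          * pairForm (fun x => circleRe (h x)) (fun x => circleIm (h x)) v x := by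
    intro W h1 h2
    rw [ambientForm_apply, h2]
    simp only [h1]
    rfl
  exact key _ h1 h2

/-- The radial projection to the sphere. -/
def normalizeSphere (w : OddSpace n) (hw : w ≠ 0) : EvenSphere n :=
  ⟨‖w‖⁻¹ • w, mem_sphere_zero_iff_norm.2 (norm_smul_inv_norm (𝕜 := ℝ) hw)⟩

theorem contMDiff_normalizeSphere {F : Type*} [NormedAddCommGroup F] [NormedSpace ℝ F]
    {K : Type*} [TopologicalSpace K] {J : ModelWithCorners ℝ F K} {T : Type*} [TopologicalSpace T]
    [ChartedSpace K T] [IsManifold J ∞ T] {w : T → OddSpace n}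
    (hw : ContMDiff J 𝓘(ℝ, OddSpace n) ∞ w) (hne : ∀ q, w q ≠ 0) :
    ContMDiff J (𝓡 (2 * n)) ∞ (fun q => normalizeSphere (w q) (hne q)) := by
  refine ContMDiff.codRestrict_sphere (n := 2 * n) (f := fun q => ‖w q‖⁻¹ • w q) ?_
    (fun q => (normalizeSphere (w q) (hne q)).2)
  intro q
  have h : ContDiffAt ℝ ∞ (fun w : OddSpace n => ‖w‖⁻¹ • w) (w q) :=
    ((contDiffAt_norm ℝ (hne q)).inv (norm_ne_zero_iff.2 (hne q))).smul contDiffAt_id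
  exact h.contMDiffAt.comp q (hw q)

/-- The vector `(x, 0, 1)`. -/
def hatVector (x : EuclideanSpace ℝ (Fin n)) : OddSpace n :=
  WithLp.toLp 2 (Sum.elim (fun i => x i) (Sum.elim (fun _ => 0) fun _ => 1))

theorem hatVector_ne_zero (x : EuclideanSpace ℝ (Fin n)) : hatVector x ≠ 0 := by
  intro h
  have h1 : (hatVector x) (Sum.inr (Sum.inr ())) = (0 : OddSpace n) (Sum.inr (Sum.inr ())) := by
    rw [h]
  simp [hatVector] at h1

/-- The central projection of the plane `{(x, 0, 1)}` to the sphere, at the point `u` of the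
circle. -/
def legendrianMap (u : Circle) (x : EuclideanSpace ℝ (Fin n)) : SphereCircle n :=
  (normalizeSphere (hatVector x) (hatVector_ne_zero x), u)

theorem contDiff_hatVector : ContDiff ℝ ∞ (hatVector (n := n)) := by
  rw [contDiff_euclidean]
  rintro (i | i | i)
  · change ContDiff ℝ ∞ fun x : EuclideanSpace ℝ (Fin n) => x i
    fun_prop
  · exact contDiff_const
  · exact contDiff_const

theorem contMDiff_legendrianMap (u : Circle) :
    ContMDiff 𝓘(ℝ, EuclideanSpace ℝ (Fin n)) (sphereCircleModel n) ∞ (legendrianMap (n := n) u) :=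
  (contMDiff_normalizeSphere contDiff_hatVector.contMDiff hatVector_ne_zero).prodMk
    contMDiff_const

/-- On the disc y = 0 and θ is constant, so every term of λ vanishes. -/
theorem contactForm_legendrianMap (u : Circle) (x v : EuclideanSpace ℝ (Fin n)) :
    contactForm (legendrianMap u x) (mfderiv 𝓘(ℝ, EuclideanSpace ℝ (Fin n)) (sphereCircleModel n)
      (legendrianMap u) x v) = 0 := by
  rw [contactForm_mfderiv_param (contMDiff_legendrianMap u)]
  have h1 : ∀ i : Fin n, (fun x : EuclideanSpace ℝ (Fin n) =>
      sphereCoord (Sum.inr (Sum.inl i)) (legendrianMap u x)) = fun _ => (0 : ℝ) := by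
    intro i
    funext x
    change ‖hatVector x‖⁻¹ * 0 = (0 : ℝ)
    rw [mul_zero]
  have h2 : (fun x : EuclideanSpace ℝ (Fin n) => circleRe (legendrianMap u x))
      = fun _ => (u : ℂ).re := rfl
  have h3 : (fun x : EuclideanSpace ℝ (Fin n) => circleIm (legendrianMap u x))
      = fun _ => (u : ℂ).im := rfl
  simp only [h1, h2, h3]
  simp [pairForm]

/-- The images of the Legendrian disc under contactomorphisms are Legendrian. -/
theorem contactForm_comp_legendrianMap (f : ContactDiffGroup (contactStructure n)) (u : Circle)
    (x v : EuclideanSpace ℝ (Fin n)) :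
    contactForm ((f : DiffGroup (sphereCircleModel n) (SphereCircle n)) (legendrianMap u x))
      (mfderiv 𝓘(ℝ, EuclideanSpace ℝ (Fin n)) (sphereCircleModel n) (fun x =>
        (f : DiffGroup (sphereCircleModel n) (SphereCircle n)) (legendrianMap u x)) x v) = 0 := by
  have h1 := DFunLike.congr_fun (mfderiv_comp x
    ((f : DiffGroup (sphereCircleModel n) (SphereCircle n)).mdifferentiable (by simp)
      (legendrianMap u x))
    ((contMDiff_legendrianMap u x).mdifferentiableAt (by simp))) v
  have h2 : mfderiv (sphereCircleModel n) (sphereCircleModel n)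
      (f : DiffGroup (sphereCircleModel n) (SphereCircle n)) (legendrianMap u x)
      (mfderiv 𝓘(ℝ, EuclideanSpace ℝ (Fin n)) (sphereCircleModel n) (legendrianMap u) x v)
      ∈ contactStructure n ((f : DiffGroup (sphereCircleModel n) (SphereCircle n))
        (legendrianMap u x)) := by
    rw [← f.2 (legendrianMap u x)]
    exact ⟨_, contactForm_legendrianMap u x v, rfl⟩
  exact (congrArg (contactForm ((f : DiffGroup (sphereCircleModel n) (SphereCircle n))
    (legendrianMap u x))) h1).trans h2

end LegendrianDisc

/-! ### The frame determinant: nonvanishing and continuity -/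

section FrameDeterminant

variable {n : ℕ}

/-- The complex determinant of the Lagrangian frame that `f` makes of the Legendrian disc at the
point `u` of the circle. -/
def frameDet (f : DiffGroup (sphereCircleModel n) (SphereCircle n)) (u : Circle) : ℂ :=
  (frameMatrix (fun i x => sphereCoord (Sum.inl i) (f (legendrianMap u x)))
    (fun i x => sphereCoord (Sum.inr (Sum.inl i)) (f (legendrianMap u x)))
    (fun x => sphereCoord (Sum.inr (Sum.inr ())) (f (legendrianMap u x)))
    (fun x => circleRe (f (legendrianMap u x))) (fun x => circleIm (f (legendrianMap u x)))
    (fun j => EuclideanSpace.single j (1 : ℝ)) 0).det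

/-- A product whose second factor vanishes at the origin. -/
theorem fderiv_mul_coord {ψ : EuclideanSpace ℝ (Fin n) → ℝ} (hψ : DifferentiableAt ℝ ψ 0)
    (i : Fin n) (v : EuclideanSpace ℝ (Fin n)) :
    fderiv ℝ (fun x : EuclideanSpace ℝ (Fin n) => ψ x * x i) 0 v = ψ 0 * v i := by
  have h := hψ.hasFDerivAt.mul
    (EuclideanSpace.proj (𝕜 := ℝ) i : EuclideanSpace ℝ (Fin n) →L[ℝ] ℝ).hasFDerivAt
  refine (DFunLike.congr_fun h.fderiv v).trans ?_
  simp

theorem hatVector_norm_zero : ‖hatVector (0 : EuclideanSpace ℝ (Fin n))‖ = 1 := by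
  have h : ‖hatVector (0 : EuclideanSpace ℝ (Fin n))‖ ^ 2 = 1 := by
    rw [norm_sq_oddSpace]
    simp [hatVector, horizontalNormSq, planeNormSq]
  exact (pow_eq_one_iff_of_nonneg (norm_nonneg _) two_ne_zero).1 h

theorem differentiable_inv_norm_hatVector :
    Differentiable ℝ fun x : EuclideanSpace ℝ (Fin n) => ‖hatVector x‖⁻¹ := fun x =>
  (((contDiff_hatVector.differentiable (by simp)) x).norm ℝ (hatVector_ne_zero x)).inv
    (norm_ne_zero_iff.2 (hatVector_ne_zero x))

/-- The coordinate x_i on the disc is the parameter x_i over ‖(x, 0, 1)‖, with differential dx_i at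
the origin. -/
theorem injective_mfderiv_legendrianMap (u : Circle) (v : EuclideanSpace ℝ (Fin n))
    (hv : (mfderiv 𝓘(ℝ, EuclideanSpace ℝ (Fin n)) (sphereCircleModel n) (legendrianMap u) 0 v :
      TangentSpace (sphereCircleModel n) (legendrianMap u (0 : EuclideanSpace ℝ (Fin n)))) = 0) :
    v = 0 := by
  ext i
  have h1 := (coordDifferential_mfderiv_param (contMDiff_legendrianMap u) 0 v).1 (Sum.inl i)
  have h2 : fderiv ℝ (fun x => sphereCoord (Sum.inl i) (legendrianMap u x)) 0 v = v i := by
    refine (fderiv_mul_coord (differentiable_inv_norm_hatVector 0) i v).trans ?_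
    rw [hatVector_norm_zero, inv_one, one_mul]
  rw [← h2, ← h1]
  have h3 : coordDifferential (legendrianMap u (0 : EuclideanSpace ℝ (Fin n)))
      (mfderiv 𝓘(ℝ, EuclideanSpace ℝ (Fin n)) (sphereCircleModel n) (legendrianMap u) 0 v) = 0 :=
    (congrArg _ hv).trans (map_zero _)
  exact congrArg (fun w : OddSpace n × ℝ => w.1 (Sum.inl i)) h3

/-- The image of the disc is Legendrian because f preserves ξ, and immersed at the pole because df
is invertible and the disc is immersed there. -/
theorem frameDet_ne_zero (f : ContactDiffGroup (contactStructure n)) (u : Circle) :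
    frameDet (f : DiffGroup (sphereCircleModel n) (SphereCircle n)) u ≠ 0 := by
  obtain ⟨f, hf⟩ := f
  have hh : ContMDiff 𝓘(ℝ, EuclideanSpace ℝ (Fin n)) (sphereCircleModel n) ∞
      (fun x => f (legendrianMap u x)) := f.contMDiff.comp (contMDiff_legendrianMap u)
  have hg : ∀ g : C^∞⟮sphereCircleModel n, SphereCircle n; ℝ⟯,
      ContDiff ℝ ∞ fun x => g (f (legendrianMap u x)) := fun g => (g.contMDiff.comp hh).contDiff
  refine det_frameMatrix_ne_zero (fun i => hg _) (fun i => hg _) (hg _) (hg _) (hg _)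
    (fun q => sum_sq_add_sq_evenSphere (f (legendrianMap u q)).1) (fun q => ?_) (fun q v => ?_)
    (fun r h1 h2 h3 h4 => ?_)
  · have h := Circle.normSq_coe (f (legendrianMap u q)).2
    rw [Complex.normSq_apply] at h
    rw [sq, sq]
    exact h
  · exact (contactForm_mfderiv_param hh q v).symm.trans
      (contactForm_comp_legendrianMap ⟨f, hf⟩ u q v)
  · set v : EuclideanSpace ℝ (Fin n) := ∑ j, r j • EuclideanSpace.single j (1 : ℝ) with hv
    obtain ⟨k1, k2⟩ := coordDifferential_mfderiv_param hh 0 v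
    have k3 : coordDifferential (f (legendrianMap u 0)) (mfderiv 𝓘(ℝ, EuclideanSpace ℝ (Fin n))
        (sphereCircleModel n) (fun x => f (legendrianMap u x)) 0 v) = 0 := by
      refine Prod.ext ?_ (k2.trans h4)
      ext j
      rcases j with i | i | i
      · exact (k1 _).trans (h1 i)
      · exact (k1 _).trans (h2 i)
      · exact (k1 _).trans h3
    have k4 := coordDifferential_injective _ (k3.trans (map_zero _).symm)
    have k5 := DFunLike.congr_fun (mfderiv_comp (0 : EuclideanSpace ℝ (Fin n))
      (f.mdifferentiable (by simp) (legendrianMap u 0))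
      ((contMDiff_legendrianMap u 0).mdifferentiableAt (by simp))) v
    have k6 := DFunLike.congr_fun (DiffGroup.mfderiv_symm_comp f (legendrianMap u 0))
      (mfderiv 𝓘(ℝ, EuclideanSpace ℝ (Fin n)) (sphereCircleModel n) (legendrianMap u) 0 v)
    have k7 := injective_mfderiv_legendrianMap u v (k6.symm.trans
      ((congrArg (mfderiv (sphereCircleModel n) (sphereCircleModel n) f.symm
        (f (legendrianMap u 0))) (k5.symm.trans k4)).trans (map_zero _)))
    funext i
    have k8 := congrArg (fun w : EuclideanSpace ℝ (Fin n) => w i) k7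
    simpa [hv, Pi.single_apply] using k8

/-- The vector `q + t (e_j - ⟨q, e_j⟩ q)`, where `e_j` is the unit vector in the direction of
`x_j`. -/
def meridianVector (j : Fin n) (t : ℝ) (q : OddSpace n) : OddSpace n :=
  q + t • (EuclideanSpace.single (Sum.inl j) (1 : ℝ) - q (Sum.inl j) • q)

/-- What is added to q is orthogonal to q, so the inner product with q stays 1. -/
theorem meridianVector_ne_zero (j : Fin n) (t : ℝ) (q : EvenSphere n) :
    meridianVector j t (q : OddSpace n) ≠ 0 := by
  intro h
  have h1 : inner ℝ (q : OddSpace n) (meridianVector j t (q : OddSpace n)) = 1 := by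
    rw [meridianVector, inner_add_right, inner_smul_right, inner_sub_right, inner_smul_right,
      real_inner_self_eq_norm_sq, mem_sphere_zero_iff_norm.1 q.2]
    simp [EuclideanSpace.inner_single_right]
  rw [h, inner_zero_right] at h1
  exact zero_ne_one h1

/-- A family of maps that starts at the identity, with velocity the projection of `∂/∂x_j`. -/
def meridianMap (j : Fin n) (a : ℝ × SphereCircle n) : SphereCircle n :=
  (normalizeSphere (meridianVector j a.1 (a.2.1 : OddSpace n)) (meridianVector_ne_zero j a.1 a.2.1),
    a.2.2)

theorem contMDiff_meridianMap (j : Fin n) :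
    ContMDiff (𝓘(ℝ, ℝ).prod (sphereCircleModel n)) (sphereCircleModel n) ∞ (meridianMap j) := by
  have h1 : ContDiff ℝ ∞ fun a : ℝ × OddSpace n => meridianVector j a.1 a.2 := by
    unfold meridianVector
    fun_prop
  have h2 : ContMDiff (𝓘(ℝ, ℝ).prod (sphereCircleModel n)) 𝓘(ℝ, OddSpace n) ∞
      fun a : ℝ × SphereCircle n => meridianVector j a.1 (a.2.1 : OddSpace n) :=
    h1.contMDiff.comp (contMDiff_fst.prodMk_space
      (contMDiff_evenSphere_coe.comp (contMDiff_fst.comp contMDiff_snd)))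
  exact (contMDiff_normalizeSphere h2 fun a => meridianVector_ne_zero j a.1 a.2.1).prodMk
    (contMDiff_snd.comp contMDiff_snd)

theorem meridianMap_zero (j : Fin n) (p : SphereCircle n) : meridianMap j (0, p) = p := by
  refine Prod.ext (Subtype.ext ?_) rfl
  change ‖meridianVector j 0 (p.1 : OddSpace n)‖⁻¹ • meridianVector j 0 (p.1 : OddSpace n) = p.1
  have h : meridianVector j 0 (p.1 : OddSpace n) = p.1 := by simp [meridianVector]
  rw [h, mem_sphere_zero_iff_norm.1 p.1.2, inv_one, one_smul]

/-- At the pole e_j is already tangent, so the curve is the central projection of (t e_j, 0, 1) and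
stays in the disc. -/
theorem meridianMap_pole (j : Fin n) (t : ℝ) (u : Circle) :
    meridianMap j (t, legendrianMap u 0) = legendrianMap u (t • EuclideanSpace.single j 1) := by
  have h : meridianVector j t ((legendrianMap u (0 : EuclideanSpace ℝ (Fin n))).1 : OddSpace n)
      = hatVector (t • EuclideanSpace.single j (1 : ℝ)) := by
    have h1 : ((legendrianMap u (0 : EuclideanSpace ℝ (Fin n))).1 : OddSpace n)
        = hatVector 0 := by
      change ‖hatVector (0 : EuclideanSpace ℝ (Fin n))‖⁻¹ • hatVector 0 = _
      rw [hatVector_norm_zero, inv_one, one_smul]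
    rw [h1]
    ext l
    rcases l with i | i | i
    · simp [meridianVector, hatVector]
    · simp [meridianVector, hatVector]
    · simp [meridianVector, hatVector]
  refine Prod.ext (Subtype.ext ?_) rfl
  change ‖meridianVector j t ((legendrianMap u (0 : EuclideanSpace ℝ (Fin n))).1 : OddSpace n)‖⁻¹
    • meridianVector j t ((legendrianMap u (0 : EuclideanSpace ℝ (Fin n))).1 : OddSpace n) = _
  rw [h]
  rfl

/-- Rewrites the derivatives in the frame matrix as Lie derivatives along global vector fields, the
quantities by which the topology of Diff(V) is defined. -/
theorem fderiv_comp_legendrianMap (g : C^∞⟮sphereCircleModel n, SphereCircle n; ℝ⟯)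
    (f : DiffGroup (sphereCircleModel n) (SphereCircle n)) (u : Circle) (j : Fin n) :
    fderiv ℝ (fun x => g (f (legendrianMap u x))) 0 (EuclideanSpace.single j 1)
      = iteratedLie [velocityField (meridianMap j) (contMDiff_meridianMap j) (meridianMap_zero j)]
        (fun p => g (f p)) (legendrianMap u 0) := by
  have h1 := mfderiv_velocityField (contMDiff_meridianMap j) (meridianMap_zero j)
    (g.contMDiff.comp f.contMDiff) (legendrianMap u 0)
  refine Eq.trans ?_ h1.symm
  have h2 : ContDiff ℝ ∞ fun x => g (f (legendrianMap u x)) :=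
    (g.contMDiff.comp (f.contMDiff.comp (contMDiff_legendrianMap u))).contDiff
  have h3 : HasDerivAt (fun t : ℝ => t • EuclideanSpace.single j (1 : ℝ))
      (EuclideanSpace.single j (1 : ℝ)) 0 := by
    simpa using (hasDerivAt_id (0 : ℝ)).smul_const (EuclideanSpace.single j (1 : ℝ))
  have h4 : HasFDerivAt (fun x => g (f (legendrianMap u x)))
      (fderiv ℝ (fun x => g (f (legendrianMap u x))) 0)
      ((0 : ℝ) • EuclideanSpace.single j (1 : ℝ)) := by
    rw [zero_smul]
    exact ((h2.differentiable (by simp)) 0).hasFDerivAt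
  have h5 := (h4.comp_hasDerivAt 0 h3).deriv
  simp only [Function.comp_def] at h5 ⊢
  simp only [meridianMap_pole]
  exact h5.symm

/-- Evaluation is continuous for the topology of uniform convergence on compact sets. -/
theorem continuous_eval_uniformOnFun {S N : Type*} [TopologicalSpace S] [TopologicalSpace N]
    [LocallyCompactSpace N] {φ : S → UniformOnFun N ℝ {K : Set N | IsCompact K}}
    (hφ : Continuous φ) (hc : ∀ s, Continuous (UniformOnFun.toFun {K : Set N | IsCompact K} (φ s))) :
    Continuous fun q : S × N => UniformOnFun.toFun {K : Set N | IsCompact K} (φ q.1) q.2 := by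
  have h : Continuous fun s => (⟨_, hc s⟩ : C(N, ℝ)) :=
    ContinuousMap.isUniformEmbedding_toUniformOnFunIsCompact.isInducing.continuous_iff.2 hφ
  exact ContinuousMap.continuous_uncurry_of_continuous ⟨_, h⟩

theorem continuous_iteratedLie_eval {S : Type*} [TopologicalSpace S]
    {γ : S → DiffGroup (sphereCircleModel n) (SphereCircle n)} (hγ : Continuous γ)
    (g : C^∞⟮sphereCircleModel n, SphereCircle n; ℝ⟯)
    (L : List (SmoothVectorField (sphereCircleModel n) (SphereCircle n))) :
    Continuous fun q : S × Circle =>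
      iteratedLie L (fun p => g (γ q.1 p)) (legendrianMap q.2 0) := by
  have h1 := continuous_eval_uniformOnFun
    ((DiffGroup.continuous_iteratedLieComp g L).comp hγ) (fun s => ?_)
  · have h2 : Continuous fun q : S × Circle => (q.1, legendrianMap (n := n) q.2 0) :=
      continuous_fst.prodMk (continuous_const.prodMk continuous_snd)
    exact h1.comp h2
  · have h3 : ContMDiff (𝓘(ℝ, ℝ).prod (sphereCircleModel n)) 𝓘(ℝ, ℝ) ∞
        fun q : ℝ × SphereCircle n => g (γ s q.2) :=
      g.contMDiff.comp ((γ s).contMDiff.comp contMDiff_snd)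
    exact (contMDiff_iteratedLie_family L h3).continuous.comp
      (continuous_const.prodMk continuous_id : Continuous fun p : SphereCircle n => ((0 : ℝ), p))

theorem continuous_frameDet {S : Type*} [TopologicalSpace S]
    {γ : S → DiffGroup (sphereCircleModel n) (SphereCircle n)} (hγ : Continuous γ) :
    Continuous fun q : S × Circle => frameDet (γ q.1) q.2 := by
  have h0 : ∀ g : C^∞⟮sphereCircleModel n, SphereCircle n; ℝ⟯,
      Continuous fun q : S × Circle => (g (γ q.1 (legendrianMap q.2 0)) : ℝ) := fun g =>
    continuous_iteratedLie_eval hγ g []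
  have h1 : ∀ (g : C^∞⟮sphereCircleModel n, SphereCircle n; ℝ⟯) (j : Fin n),
      Continuous fun q : S × Circle => fderiv ℝ (fun x => g (γ q.1 (legendrianMap q.2 x))) 0
        (EuclideanSpace.single j 1) := by
    intro g j
    simp only [fderiv_comp_legendrianMap]
    exact continuous_iteratedLie_eval hγ g _
  have h0' := fun g => Complex.continuous_ofReal.comp (h0 g)
  have h1' := fun g j => Complex.continuous_ofReal.comp (h1 g j)
  refine Continuous.matrix_det (continuous_matrix ?_)
  rintro (i | i) (j | j)
  · exact (h1' _ j).add ((h1' _ j).mul continuous_const)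
  · exact (Complex.continuous_ofReal.comp ((h0 _).div_const 2)).add
      ((Complex.continuous_ofReal.comp ((h0 _).div_const 2)).mul continuous_const)
  · exact (h1' _ j).add ((Complex.continuous_ofReal.comp
      (((h0 _).mul (h1 _ j)).sub ((h0 _).mul (h1 _ j)))).mul continuous_const)
  · exact h0' _

end FrameDeterminant

/-! ### Powers of Ψ_c and the conclusion -/

section Powers

variable {n : ℕ}

theorem planeRotation_mul (k : Fin n) (w u : ℂ) (q : OddSpace n) :
    planeRotation k w (planeRotation k u q) = planeRotation k (w * u) q := by
  ext j
  rcases j with i | i | i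
  · by_cases hi : i = k
    · subst hi
      simp [planeRotation]
      ring
    · simp [planeRotation, hi]
  · by_cases hi : i = k
    · subst hi
      simp [planeRotation]
      ring
    · simp [planeRotation, hi]
  · rfl

theorem planeNormSq_planeRotation (k i : Fin n) (u : Circle) (q : OddSpace n) :
    planeNormSq i (planeRotation k (u : ℂ) q) = planeNormSq i q := by
  have hu : (u : ℂ).re * (u : ℂ).re + (u : ℂ).im * (u : ℂ).im = 1 := by
    have h := Circle.normSq_coe u
    rwa [Complex.normSq_apply] at h
  simp only [planeNormSq, planeRotation, Sum.elim_inl, Sum.elim_inr]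
  split_ifs
  · linear_combination (q (Sum.inl i) ^ 2 + q (Sum.inr (Sum.inl i)) ^ 2) * hu
  · rfl

/-- Height and factor of the shear depend only on z and the x_i² + y_i², which the rotation
preserves. Hence the m-th power of Ψ_c is Ψ^m after the shear with parameter m. -/
theorem shearMap_planeRotation (k : Fin n) (t : ℝ) (u : Circle) (q : OddSpace n) :
    shearMap k t (planeRotation k (u : ℂ) q) = planeRotation k (u : ℂ) (shearMap k t q) := by
  have h1 : shearHeight k t (planeRotation k (u : ℂ) q) = shearHeight k t q := by
    simp only [shearHeight, planeNormSq_planeRotation]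
    rfl
  have h2 : shearFactor k t (planeRotation k (u : ℂ) q) = shearFactor k t q := by
    simp only [shearFactor, horizontalNormSq, planeNormSq_planeRotation, h1]
  ext j
  rcases j with i | i | i
  · simp only [shearMap, planeRotation, Sum.elim_inl, Sum.elim_inr] at h1 h2 ⊢
    rw [h2]
    split_ifs <;> ring
  · simp only [shearMap, planeRotation, Sum.elim_inl, Sum.elim_inr] at h1 h2 ⊢
    rw [h2]
    split_ifs <;> ring
  · simp only [shearMap, planeRotation, Sum.elim_inl, Sum.elim_inr] at h1 h2 ⊢
    rw [h1, h2]

theorem rotationContactomorphism_pow_apply (k : Fin n) (m : ℕ) (p : SphereCircle n) :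
    ((((rotationContactomorphism k ^ m : ContactDiffGroup (contactStructure n)) :
      DiffGroup (sphereCircleModel n) (SphereCircle n)) p).1 : OddSpace n)
      = planeRotation k ((p.2 : ℂ) ^ m) (shearMap k m (p.1 : OddSpace n)) ∧
    (((rotationContactomorphism k ^ m : ContactDiffGroup (contactStructure n)) :
      DiffGroup (sphereCircleModel n) (SphereCircle n)) p).2 = p.2 := by
  induction m with
  | zero =>
    refine ⟨?_, rfl⟩
    rw [pow_zero, pow_zero, Nat.cast_zero, shearMap_zero]
    change (p.1 : OddSpace n) = _
    ext j
    rcases j with i | i | i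
    · simp [planeRotation]
    · simp [planeRotation]
    · rfl
  | succ m ih =>
    set g := ((rotationContactomorphism k ^ m : ContactDiffGroup (contactStructure n)) :
      DiffGroup (sphereCircleModel n) (SphereCircle n)) with hg
    have h1 : ((rotationContactomorphism k ^ (m + 1) : ContactDiffGroup (contactStructure n)) :
        DiffGroup (sphereCircleModel n) (SphereCircle n)) p
        = rotationDiffeo k (shearDiffeo k 1 (g p)) := by
      rw [pow_succ']
      rfl
    have h2 : (g p).2 = p.2 := ih.2
    rw [h1]
    refine ⟨?_, h2⟩
    change planeRotation k ((g p).2 : ℂ) (shearMap k 1 ((g p).1 : OddSpace n)) = _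
    rw [h2, ih.1, ← Circle.coe_pow, shearMap_planeRotation, planeRotation_mul, shearMap_shearMap,
      Circle.coe_pow, ← pow_succ']
    push_cast
    rfl

/-- The shear fixes the pole and acts there as the identity on the (x, y)-components to first order,
so the tangent frame is only rotated: its k-th vector is multiplied by u^m in the k-th complex
coordinate. -/
theorem frameDet_rotationContactomorphism_pow (k : Fin n) (m : ℕ) (u : Circle) :
    frameDet ((rotationContactomorphism k ^ m : ContactDiffGroup (contactStructure n)) :
      DiffGroup (sphereCircleModel n) (SphereCircle n)) u = (u : ℂ) ^ m := by
  set f := ((rotationContactomorphism k ^ m : ContactDiffGroup (contactStructure n)) :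
    DiffGroup (sphereCircleModel n) (SphereCircle n)) with hf
  set w : ℂ := (u : ℂ) ^ m with hw
  set ψ : EuclideanSpace ℝ (Fin n) → ℝ := fun x =>
    √(shearFactor k m ((legendrianMap u x).1 : OddSpace n)) * ‖hatVector x‖⁻¹ with hψ
  have hp0 : ((legendrianMap u (0 : EuclideanSpace ℝ (Fin n))).1 : OddSpace n) = hatVector 0 := by
    change ‖hatVector (0 : EuclideanSpace ℝ (Fin n))‖⁻¹ • hatVector 0 = _
    rw [hatVector_norm_zero, inv_one, one_smul]
  have hplane : ∀ i, planeNormSq i (hatVector (0 : EuclideanSpace ℝ (Fin n))) = 0 := fun i => by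
    simp [planeNormSq, hatVector]
  have hhor : horizontalNormSq (hatVector (0 : EuclideanSpace ℝ (Fin n))) = 0 :=
    Finset.sum_eq_zero fun i _ => hplane i
  have hheight : shearHeight k m (hatVector (0 : EuclideanSpace ℝ (Fin n))) = 1 := by
    rw [shearHeight, hplane]
    simp [hatVector]
  have hfac : shearFactor k m (hatVector (0 : EuclideanSpace ℝ (Fin n))) = 1 := by
    rw [shearFactor, hhor, hheight]
    exact (eq_dilationFactor le_rfl (by norm_num) one_pos (by norm_num)).symm
  have hψ0 : ψ 0 = 1 := by
    simp only [hψ, hp0, hfac, hatVector_norm_zero]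
    simp
  have hψd : DifferentiableAt ℝ ψ 0 := by
    have h1 : ContDiffAt ℝ ∞ (fun a : ℝ × OddSpace n => √(shearFactor k a.1 a.2))
        ((m : ℝ), ((legendrianMap u (0 : EuclideanSpace ℝ (Fin n))).1 : OddSpace n)) :=
      (contDiffAt_shearFactor k (horizontalNormSq_add_shearHeight_pos k m _)).sqrt
        (shearFactor_pos k m _).ne'
    have h2 : ContDiff ℝ ∞ fun x : EuclideanSpace ℝ (Fin n) =>
        ((legendrianMap u x).1 : OddSpace n) :=
      ((contMDiff_evenSphere_coe.comp contMDiff_fst).comp (contMDiff_legendrianMap u)).contDiff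
    have h3 : ContDiffAt ℝ ∞ (fun x : EuclideanSpace ℝ (Fin n) =>
        ((m : ℝ), ((legendrianMap u x).1 : OddSpace n))) 0 :=
      contDiffAt_const.prodMk h2.contDiffAt
    exact ((h1.comp (0 : EuclideanSpace ℝ (Fin n)) h3).differentiableAt (by simp)).mul
      (differentiable_inv_norm_hatVector 0)
  have hc : ∀ x, ((f (legendrianMap u x)).1 : OddSpace n)
      = planeRotation k w (shearMap k m ((legendrianMap u x).1 : OddSpace n)) := fun x =>
    (rotationContactomorphism_pow_apply k m (legendrianMap u x)).1
  have hx : ∀ i x, sphereCoord (Sum.inl i) (f (legendrianMap u x))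
      = (if i = k then w.re else 1) * ψ x * x i := by
    intro i x
    change ((f (legendrianMap u x)).1 : OddSpace n) (Sum.inl i) = _
    rw [hc]
    simp only [planeRotation, shearMap, Sum.elim_inl, Sum.elim_inr, hψ]
    have h1 : ∀ i, ((legendrianMap u x).1 : OddSpace n) (Sum.inl i) = ‖hatVector x‖⁻¹ * x i :=
      fun _ => rfl
    have h2 : ∀ i, ((legendrianMap u x).1 : OddSpace n) (Sum.inr (Sum.inl i))
      = ‖hatVector x‖⁻¹ * 0 := fun _ => rfl
    simp only [h1, h2]
    split_ifs <;> ring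
  have hy : ∀ i x, sphereCoord (Sum.inr (Sum.inl i)) (f (legendrianMap u x))
      = (if i = k then w.im else 0) * ψ x * x i := by
    intro i x
    change ((f (legendrianMap u x)).1 : OddSpace n) (Sum.inr (Sum.inl i)) = _
    rw [hc]
    simp only [planeRotation, shearMap, Sum.elim_inl, Sum.elim_inr, hψ]
    have h1 : ∀ i, ((legendrianMap u x).1 : OddSpace n) (Sum.inl i) = ‖hatVector x‖⁻¹ * x i :=
      fun _ => rfl
    have h2 : ∀ i, ((legendrianMap u x).1 : OddSpace n) (Sum.inr (Sum.inl i))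
      = ‖hatVector x‖⁻¹ * 0 := fun _ => rfl
    simp only [h1, h2]
    split_ifs <;> ring
  have hz : sphereCoord (Sum.inr (Sum.inr ())) (f (legendrianMap u 0)) = 1 := by
    change ((f (legendrianMap u 0)).1 : OddSpace n) (Sum.inr (Sum.inr ())) = 1
    rw [hc, hp0]
    change shearFactor k m (hatVector 0) * shearHeight k m (hatVector 0) = 1
    rw [hfac, hheight, one_mul]
  have hdx : ∀ i j, fderiv ℝ (fun x => sphereCoord (Sum.inl i) (f (legendrianMap u x))) 0
      (EuclideanSpace.single j (1 : ℝ)) = if i = j then (if i = k then w.re else 1) else 0 := by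
    intro i j
    simp only [hx]
    rw [fderiv_mul_coord (hψd.const_mul _), hψ0]
    simp
  have hdy : ∀ i j, fderiv ℝ (fun x => sphereCoord (Sum.inr (Sum.inl i)) (f (legendrianMap u x))) 0
      (EuclideanSpace.single j (1 : ℝ)) = if i = j then (if i = k then w.im else 0) else 0 := by
    intro i j
    simp only [hy]
    rw [fderiv_mul_coord (hψd.const_mul _), hψ0]
    simp
  have hA : (Matrix.of fun i j : Fin n =>
      ((fderiv ℝ (fun x => sphereCoord (Sum.inl i) (f (legendrianMap u x))) 0
        (EuclideanSpace.single j (1 : ℝ)) : ℝ) : ℂ)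
      + ((fderiv ℝ (fun x => sphereCoord (Sum.inr (Sum.inl i)) (f (legendrianMap u x))) 0
        (EuclideanSpace.single j (1 : ℝ)) : ℝ) : ℂ) * Complex.I)
      = Matrix.diagonal fun i => if i = k then w else 1 := by
    ext i j
    rw [Matrix.of_apply, hdx, hdy, Matrix.diagonal_apply]
    split_ifs
    · exact Complex.re_add_im w
    · simp
    · simp
  have hB : (Matrix.of fun (i : Fin n) (_ : Unit) =>
      ((sphereCoord (Sum.inl i) (f (legendrianMap u 0)) / 2 : ℝ) : ℂ)
      + ((sphereCoord (Sum.inr (Sum.inl i)) (f (legendrianMap u 0)) / 2 : ℝ) : ℂ) * Complex.I)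
      = 0 := by
    ext i j
    rw [Matrix.of_apply, hx, hy]
    simp
  -- X has no (x, y)-components at the pole, so the matrix is block triangular and its lower left
  -- block plays no role.
  rw [frameDet, frameMatrix, hA, hB, Matrix.det_fromBlocks_zero₁₂, Matrix.det_diagonal]
  simp [hz]

/-- The powers of `Ψ_c` are not contact isotopic to the identity. -/
theorem eq_zero_of_joined_rotationContactomorphism_pow (k : Fin n) {m : ℕ}
    (h : Joined 1 (rotationContactomorphism k ^ m)) : m = 0 := by
  obtain ⟨γ⟩ := h
  have hγ : Continuous fun t => (γ t : DiffGroup (sphereCircleModel n) (SphereCircle n)) :=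
    continuous_subtype_val.comp γ.continuous
  have hc := continuous_frameDet hγ
  have h0 : ∀ u, frameDet (γ 0 : DiffGroup (sphereCircleModel n) (SphereCircle n)) u = 1 := by
    intro u
    have h := frameDet_rotationContactomorphism_pow k 0 u
    rw [pow_zero, pow_zero] at h
    rw [γ.source]
    exact h
  have h1 : ∀ u : Circle, frameDet (γ 1 : DiffGroup (sphereCircleModel n) (SphereCircle n)) u
      = (u : ℂ) ^ m := by
    intro u
    rw [γ.target]
    exact frameDet_rotationContactomorphism_pow k m u
  exact eq_zero_of_homotopy_pow
    (h := fun t => frameDet (γ t : DiffGroup (sphereCircleModel n) (SphereCircle n)))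
    hc (fun t u => frameDet_ne_zero (γ t) u) h0 h1

theorem infinite_zpowers_rotationContactomorphism_sq (k : Fin n) :
    Infinite (Subgroup.zpowers (PiZero.mk (rotationContactomorphism k ^ 2))) := by
  refine Set.infinite_coe_iff.2 ?_
  rw [infinite_zpowers, isOfFinOrder_iff_pow_eq_one]
  rintro ⟨m, hm, h⟩
  have h1 : PiZero.mk (1 : ContactDiffGroup (contactStructure n))
      = PiZero.mk (rotationContactomorphism k ^ (2 * m)) := by
    rw [pow_mul, map_pow, h, map_one]
  -- All powers of Ψ_c are detected, in particular the even ones: 2m = 0 contradicts m > 0.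
  have h2 := eq_zero_of_joined_rotationContactomorphism_pow k ((PiZero.mk_eq_mk_iff _ _).1 h1)
  omega

end Powers

end

theorem corollary1 (n : ℕ) (hn : 1 ≤ n) :
    IsContactKernel n ∧
    ∃ Ψc : ContactDiffGroup (contactStructure n),
      SmoothlyIsotopic (psi n hn) (Ψc : DiffGroup (sphereCircleModel n) (SphereCircle n)) ∧
      Subgroup.zpowers (PiZero.mk (Ψc ^ 2)) ≤ (piZeroInclusion (contactStructure n)).ker ∧
      Infinite (Subgroup.zpowers (PiZero.mk (Ψc ^ 2))) :=
  ⟨isContactKernel n, rotationContactomorphism ⟨n - 1, by omega⟩,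
    smoothlyIsotopic_rotationContactomorphism _,
    (Subgroup.zpowers_le).2 (mk_rotationContactomorphism_sq_mem_ker _),
    infinite_zpowers_rotationContactomorphism_sq _⟩
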